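/- **Theorem 1.1 (Structure Theorem).** Let $M$ be one of the one-manifolds $\mathbb{R}$, $[0,1)$, $[0,1]$ or $S^1=\mathbb{R}/\mathbb{Z}$, and let $G\subset \mathrm{Homeo}_+(M)$ be a finitely generated virtually nilpotent group of orientation-preserving homeomorphisms of $M$. Then there are two countable (possibly finite or empty) families $(I_i)$ and $(M_k)$ of non-empty open subsets of $M$ such that: 1. $I_i\cap I_j=\emptyset$ and $M_i\cap M_j=\emptyset$ whenever $i\ne j$, and $I_i\cap M_k=\emptyset$ for all $i,k$. 2. Each $I_i$ and each $M_k$ is $G$-invariant. 3. Every connected component $I_{i,j}$ of $I_i$ is an open interval (an open subset of $M$ homeomorphic to $\mathbb{R}$). For any two components $I_{i,j},I_{i,j'}$ of the same $I_i$ there is $g\in G$ with $g(I_{i,j})=I_{i,j'}$. If $g\in G$ and $g(I_{i,j})=I_{i,j}$, then $g|_{I_{i,j}}=\mathrm{id}$. 4. $G$ acts minimally on each $M_k$, i.e. the $G$-orbit of every point of $M_k$ is dense in $M_k$. For every connected component $M_{k,j}$ of $M_k$ the group $\{g|_{M_{k,j}} : g\in G,\ g(M_{k,j})=M_{k,j}\}$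 is abelian. 5. $\bigcup_i I_i\cup\bigcup_k M_k$ is dense in $M$. Moreover, if $M=S^1$ and $G$ acts minimally on $S^1$ (every orbit is dense), then $G$ is abelian. -/

import Mathlib

namespace OneDimDynamics

/-- A homeomorphism of the circle `ℝ / ℤ` preserves orientation if it lifts to a strictly
increasing continuous map of the line. (Homeomorphisms of intervals preserve orientation when
they are strictly increasing.) -/
def CircleOrientationPreserving (f : UnitAddCircle ≃ₜ UnitAddCircle) : Prop :=
  ∃ F : ℝ → ℝ, Continuous F ∧ StrictMono F ∧
    ∀ x : ℝ, ((F x : ℝ) : UnitAddCircle) = f (x : UnitAddCircle)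

section

variable {M : Type*} [TopologicalSpace M]

/-- `C` is a connected component of the subset `U`. -/
def IsComponentOf (C U : Set M) : Prop :=
  ∃ x ∈ U, C = connectedComponentIn U x

/-- `C` is an open interval in the one-manifold `M`: an open subset homeomorphic to the line.
In particular it contains no boundary point of `M`, and it is not a whole circle. -/
def IsOpenInterval (C : Set M) : Prop :=
  IsOpen C ∧ Nonempty (C ≃ₜ ℝ)

/-- The set `U` is invariant under the group `G` of homeomorphisms. -/
def IsInvariantSet (G : Subgroup (M ≃ₜ M)) (U : Set M) : Prop :=
  ∀ g ∈ G, g '' U = U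

/-- `G` acts minimally on the (invariant) set `U`: `U` is non-empty and the orbit of every point
of `U` is dense in `U`. -/
def ActsMinimallyOn (G : Subgroup (M ≃ₜ M)) (U : Set M) : Prop :=
  U.Nonempty ∧ ∀ x ∈ U, U ⊆ closure {y | ∃ g ∈ G, g x = y}

/-- The group of restrictions to `C` of the elements of `G` that map `C` onto itself is
abelian. -/
def StabilizerActsAbelianly (G : Subgroup (M ≃ₜ M)) (C : Set M) : Prop :=
  ∀ g ∈ G, ∀ h ∈ G, g '' C = C → h '' C = C → ∀ x ∈ C, g (h x) = h (g x)

/-- The families `I` (permuted intervals) and `N` (minimal open sets) decompose the action of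
`G` on `M`. -/
structure IsDecomposition (G : Subgroup (M ≃ₜ M)) {ι κ : Type} (I : ι → Set M) (N : κ → Set M) :
    Prop where
  isOpen_I : ∀ i, IsOpen (I i)
  isOpen_N : ∀ k, IsOpen (N k)
  nonempty_I : ∀ i, (I i).Nonempty
  disjoint_I : ∀ i j, i ≠ j → I i ∩ I j = ∅
  disjoint_N : ∀ k l, k ≠ l → N k ∩ N l = ∅
  disjoint_I_N : ∀ i k, I i ∩ N k = ∅
  invariant_I : ∀ i, IsInvariantSet G (I i)
  invariant_N : ∀ k, IsInvariantSet G (N k)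
  interval_I : ∀ i, ∀ C, IsComponentOf C (I i) → IsOpenInterval C
  transitive_I : ∀ i, ∀ C C', IsComponentOf C (I i) → IsComponentOf C' (I i) →
    ∃ g ∈ G, g '' C = C'
  trivial_I : ∀ i, ∀ C, IsComponentOf C (I i) → ∀ g ∈ G, g '' C = C → ∀ x ∈ C, g x = x
  minimal_N : ∀ k, ActsMinimallyOn G (N k)
  abelian_N : ∀ k, ∀ C, IsComponentOf C (N k) → StabilizerActsAbelianly G C
  dense_union : Dense ((⋃ i, I i) ∪ ⋃ k, N k)

/-- The action of `G` on `M` admits a decomposition into countably many permuted families of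
intervals and minimal open sets. -/
def HasDecomposition (G : Subgroup (M ≃ₜ M)) : Prop :=
  ∃ (ι κ : Type) (_ : Countable ι) (_ : Countable κ) (I : ι → Set M) (N : κ → Set M),
    IsDecomposition G I N

end

end OneDimDynamics

/-!
The group `G` is lifted to a group `Γ` acting on the line by increasing maps: for the circle through
the quotient map, with the unit translation as central kernel, and for intervals through a
parametrization of the interior. Two properties of `G` survive in `Γ` and are all that is used.
First, `Γ` is virtually polycyclic (`HirschLE`), so that root-closed proper subgroups have smaller
Hirsch length (`HirschLE.exists_lt_of_isolated`). Second, `Γ` satisfies a semigroup law on powers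
(`HasMalcevLaw`), which makes ping-pong impossible (`HasMalcevLaw.not_pingPong`).

The core is to find, in any invariant open set, an interval `J` whose translates are equal or
disjoint and on which its stabilizer acts either trivially or minimally and commutatively
(`TameInterval`). Start from a component of the open set. If its stabilizer moves some point, pass to
a component of the complement of the common fixed points, on which there is no common fixed point.
If the action there is not minimal, a gap of an orbit closure is again a block; its stabilizer is a
root-closed subgroup, and it is proper because an endpoint of the gap is not fixed by everything.
Hence the Hirsch length drops, and induction finishes (`exists_tameInterval_of_isBlock`).

A minimal action on an interval is commutative for the following reason. If some element had a
fixed point without being trivial, some translate of an endpoint of a component of its support would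
lie in that component, and contraction towards the endpoint would produce ping-pong
(`HasMalcevLaw.not_linked`). Thus the action is free, hence Archimedean, and Hölder's argument makes
it commutative (`smul_comm_of_free`). Applied to the whole line, this also gives the statement on
minimal actions on the circle.

The translates of the projection of a tame interval form a set suitable as one member of the two
families (`LineCover.isTameSet`), and a maximal disjoint family of such sets has dense union.
-/

open scoped Pointwise commutatorElement

open OneDimDynamics

/-! ### Virtually polycyclic groups and nilpotency -/

/-- `HirschLE n H`: the subgroup `H` is reached from the trivial group by finitely many extensions,
each with cyclic quotient or of finite index, at most `n` of them being cyclic. -/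
inductive HirschLE {Γ : Type} [Group Γ] : ℕ → Subgroup Γ → Prop
  | bot : HirschLE 0 ⊥
  | finite {n : ℕ} {N H : Subgroup Γ} : HirschLE n N → N ≤ H → N.relIndex H ≠ 0 → HirschLE n H
  | cyclic {n : ℕ} {N H : Subgroup Γ} {Q : Type} [Group Q] [IsCyclic Q] (φ : H →* Q) :
      HirschLE n N → N ≤ H → (∀ h : H, φ h = 1 ↔ (h : Γ) ∈ N) → HirschLE (n + 1) H

namespace HirschLE

variable {Γ : Type} [Group Γ]

theorem of_le {n : ℕ} {H K : Subgroup Γ} (h : HirschLE n H) (hK : K ≤ H) : HirschLE n K := by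
  induction h generalizing K with
  | bot =>
    obtain rfl : K = ⊥ := le_bot_iff.1 hK
    exact bot
  | @finite n N H _ hNH hi ih =>
    refine finite (ih (K := N ⊓ K) inf_le_left) inf_le_right ?_
    rw [Subgroup.inf_relIndex_right]
    exact fun h0 => hi (Subgroup.relIndex_eq_zero_of_le_right hK h0)
  | @cyclic n N H Q _ _ φ _ hNH hφ ih =>
    refine cyclic (φ.comp (Subgroup.inclusion hK)) (ih (K := N ⊓ K) inf_le_left) inf_le_right ?_
    intro h
    simp [hφ]

theorem map {Δ : Type} [Group Δ] (f : Γ →* Δ) (hf : Function.Injective f) {n : ℕ}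
    {H : Subgroup Γ} (h : HirschLE n H) : HirschLE n (H.map f) := by
  induction h with
  | bot => rw [Subgroup.map_bot]; exact bot
  | @finite n N H _ hNH hi ih =>
    refine finite ih (Subgroup.map_mono hNH) ?_
    rwa [Subgroup.relIndex_map_map_of_injective _ _ hf]
  | @cyclic n N H Q _ _ φ _ hNH hφ ih =>
    let e := H.equivMapOfInjective f hf
    refine cyclic (φ.comp e.symm.toMonoidHom) ih (Subgroup.map_mono hNH) ?_
    intro h
    obtain ⟨k, rfl⟩ := e.surjective h
    simp [hφ, e, hf.eq_iff]

/-- The bound is additive in extensions. -/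
theorem comap {Δ : Type} [Group Δ] (f : Γ →* Δ) (hf : Function.Surjective f) {m n : ℕ}
    (hker : HirschLE m f.ker) {H : Subgroup Δ} (h : HirschLE n H) :
    HirschLE (m + n) (H.comap f) := by
  induction h with
  | bot => simpa using hker
  | @finite n N H _ hNH hi ih =>
    refine finite ih (Subgroup.comap_mono hNH) ?_
    rwa [Subgroup.relIndex_comap, Subgroup.map_comap_eq_self_of_surjective hf]
  | @cyclic n N H Q _ _ φ _ hNH hφ ih =>
    refine cyclic (φ.comp (f.subgroupComap H)) ih (Subgroup.comap_mono hNH) ?_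
    exact fun h => hφ _

/-- A proper root-closed subgroup has infinite index, and loses a cyclic extension. -/
theorem exists_lt_of_isolated {n : ℕ} {H P : Subgroup Γ} (h : HirschLE n H) (hP : P ≤ H)
    (hne : P ≠ H) (hroot : ∀ x ∈ H, ∀ k : ℤ, k ≠ 0 → x ^ k ∈ P → x ∈ P) :
    ∃ m < n, HirschLE m P := by
  induction h generalizing P with
  | bot => exact absurd (le_bot_iff.1 hP) hne
  | @finite n N H _ hNH hi ih =>
    by_cases hNP : N ≤ P
    · refine absurd (le_antisymm hP fun x hx => ?_) hne
      obtain ⟨k, hk0, -, hk⟩ := Subgroup.exists_pow_mem_of_relIndex_ne_zero hi hx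
      exact hroot x hx k (by omega) (by simpa using hNP hk.1)
    · obtain ⟨m, hm, hmP⟩ := ih (P := N ⊓ P) inf_le_left (fun h => hNP (inf_eq_left.1 h))
        fun x hx k hk hxk => ⟨hx, hroot x (hNH hx) k hk hxk.2⟩
      refine ⟨m, hm, finite hmP inf_le_right ?_⟩
      rw [Subgroup.inf_relIndex_right]
      exact fun h0 => hi (Subgroup.relIndex_eq_zero_of_le_right hP h0)
  | @cyclic n N H Q _ _ φ hN hNH hφ ih =>
    by_cases hNP : N ≤ P
    · -- a nontrivial element of `P / N` is commensurable with every element of `H / N`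
      refine ⟨n, n.lt_succ_self, hN.of_le fun p hp => ?_⟩
      by_contra hpN
      obtain ⟨c, hc⟩ := IsCyclic.exists_generator (α := Q)
      obtain ⟨k, hk⟩ := Subgroup.mem_zpowers_iff.1 (hc (φ ⟨p, hP hp⟩))
      have hk0 : k ≠ 0 := by
        rintro rfl
        exact hpN ((hφ ⟨p, hP hp⟩).1 (by rw [← hk, zpow_zero]))
      refine hne (le_antisymm hP fun t ht => hroot t ht k hk0 ?_)
      obtain ⟨l, hl⟩ := Subgroup.mem_zpowers_iff.1 (hc (φ ⟨t, ht⟩))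
      have h1 : (t ^ k * (p ^ l)⁻¹ : Γ) ∈ N := by
        refine (hφ (⟨t, ht⟩ ^ k * (⟨p, hP hp⟩ ^ l)⁻¹)).1 ?_
        rw [map_mul, map_inv, map_zpow, map_zpow, ← hk, ← hl, ← zpow_mul, ← zpow_mul, mul_comm k l,
          mul_inv_cancel]
      simpa using P.mul_mem (hNP h1) (P.zpow_mem hp l)
    · obtain ⟨m, hm, hmP⟩ := ih (P := N ⊓ P) inf_le_left (fun h => hNP (inf_eq_left.1 h))
        fun x hx k hk hxk => ⟨hx, hroot x (hNH hx) k hk hxk.2⟩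
      refine ⟨m + 1, by omega,
        cyclic (φ.comp (Subgroup.inclusion hP)) hmP inf_le_right fun h => ?_⟩
      simp [hφ]

theorem sup_zpowers {n : ℕ} {N : Subgroup Γ} [N.Normal] (h : HirschLE n N) (s : Γ) :
    HirschLE (n + 1) (N ⊔ Subgroup.zpowers s) := by
  let π := QuotientGroup.mk' N
  have hH : N ⊔ Subgroup.zpowers s ≤ (Subgroup.zpowers (π s)).comap π := by
    rw [sup_le_iff]
    constructor
    · intro x hx
      have : π x = 1 := (QuotientGroup.eq_one_iff x).2 hx
      simp [this]
    · simp [Subgroup.zpowers_le]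
  refine cyclic (((π.comp (N ⊔ Subgroup.zpowers s).subtype).codRestrict (Subgroup.zpowers (π s)))
    fun x => hH x.2) h le_sup_left fun x => ?_
  rw [← Subtype.coe_inj]
  exact QuotientGroup.eq_one_iff (x : Γ)

end HirschLE

section Nilpotent

variable {Γ : Type} [Group Γ]

open Subgroup

theorem normal_of_between_lowerCentralSeries {i : ℕ} {B : Subgroup Γ}
    (h1 : (⊤ : Subgroup Γ).lowerCentralSeries (i + 1) ≤ B)
    (h2 : B ≤ (⊤ : Subgroup Γ).lowerCentralSeries i) : B.Normal := by
  refine ⟨fun b hb g => ?_⟩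
  have : ⁅b, g⁆ ∈ B := h1 (commutator_mem_commutator (h2 hb) (mem_top g))
  have h3 := B.mul_mem (B.inv_mem this) hb
  have h4 : ⁅b, g⁆⁻¹ * b = g * b * g⁻¹ := by group
  rwa [h4] at h3

/-- The factors of the lower central series of a finitely generated group are finitely generated:
commutators of generators generate the next factor, because commutation is bimultiplicative
modulo the following term. -/
theorem exists_finset_lowerCentralSeries [Group.FG Γ] (i : ℕ) :
    ∃ S : Finset Γ, (⊤ : Subgroup Γ).lowerCentralSeries i =
      (⊤ : Subgroup Γ).lowerCentralSeries (i + 1) ⊔ closure (S : Set Γ) := by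
  classical
  obtain ⟨T, hT⟩ := (Group.fg_def.1 ‹Group.FG Γ›)
  induction i with
  | zero => exact ⟨T, by simp [hT]⟩
  | succ i ih =>
    obtain ⟨S, hS⟩ := ih
    set L := (⊤ : Subgroup Γ).lowerCentralSeries with hL
    let C : Finset Γ := (S ×ˢ T).image fun p => ⁅p.1, p.2⁆
    set B := L (i + 2) ⊔ closure (C : Set Γ) with hB
    have hBL : B ≤ L (i + 1) := by
      refine sup_le (Subgroup.lowerCentralSeries_antitone _ (Nat.le_succ _)) ?_
      rw [closure_le]
      intro x hx
      simp only [C, Finset.coe_image, Set.mem_image, Finset.mem_coe, Finset.mem_product] at hx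
      obtain ⟨p, hp, rfl⟩ := hx
      refine commutator_mem_commutator ?_ (mem_top _)
      rw [← hL, hS]
      exact mem_sup_right (subset_closure hp.1)
    have hN : B.Normal := normal_of_between_lowerCentralSeries le_sup_left hBL
    have key : ∀ x g : Γ, ⁅x, g⁆ ∈ B ↔
        QuotientGroup.mk' B x * QuotientGroup.mk' B g =
          QuotientGroup.mk' B g * QuotientGroup.mk' B x := by
      intro x g
      rw [← QuotientGroup.eq_one_iff, ← QuotientGroup.mk'_apply, map_commutatorElement,
        commutatorElement_eq_one_iff_mul_comm]
    refine ⟨C, le_antisymm ?_ hBL⟩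
    rw [hL, Subgroup.lowerCentralSeries_succ, commutator_le, ← hL]
    have hgen : ∀ s ∈ S, ∀ g : Γ, ⁅s, g⁆ ∈ B := by
      intro s hs g
      have hle : (⊤ : Subgroup Γ) ≤
          (centralizer {QuotientGroup.mk' B s}).comap (QuotientGroup.mk' B) := by
        rw [← hT, closure_le]
        intro t ht
        simp only [SetLike.mem_coe, mem_comap, mem_centralizer_singleton_iff]
        refine ((key s t).1 (mem_sup_right (subset_closure ?_))).symm
        exact Finset.mem_image.2 ⟨(s, t), Finset.mem_product.2 ⟨hs, ht⟩, rfl⟩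
      have := hle (mem_top g)
      simp only [mem_comap, mem_centralizer_singleton_iff] at this
      exact (key s g).2 this.symm
    have hall : L i ≤ (center (Γ ⧸ B)).comap (QuotientGroup.mk' B) := by
      rw [hS, sup_le_iff, closure_le]
      constructor
      · intro x hx
        rw [mem_comap, mem_center_iff]
        intro g
        obtain ⟨g, rfl⟩ := QuotientGroup.mk'_surjective B g
        exact ((key x g).1 (mem_sup_left (commutator_mem_commutator hx (mem_top g)))).symm
      · intro s hs
        rw [SetLike.mem_coe, mem_comap, mem_center_iff]
        intro g
        obtain ⟨g, rfl⟩ := QuotientGroup.mk'_surjective B g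
        exact ((key s g).1 (hgen s hs g)).symm
    intro x hx g _
    have := hall hx
    rw [mem_comap, mem_center_iff] at this
    exact (key x g).2 (this _).symm

/-- A finitely generated virtually nilpotent group is virtually polycyclic. -/
theorem HirschLE.of_isVirtuallyNilpotent [Group.FG Γ] (h : Group.IsVirtuallyNilpotent Γ) :
    ∃ n, HirschLE n (⊤ : Subgroup Γ) := by
  obtain ⟨K, hK, hfi⟩ := h
  have : Group.FG K := Subgroup.fg_of_index_ne_zero K
  obtain ⟨c, hc⟩ : ∃ c, (⊤ : Subgroup K).lowerCentralSeries c = ⊥ := by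
    obtain ⟨c, hc⟩ := (isNilpotent_iff_lowerCentralSeries K).1 hK
    rw [← top_subtype_lowerCentralSeries] at hc
    exact ⟨c, (map_eq_bot_iff_of_injective _ K.subtype_injective).1 hc⟩
  have step : ∀ (i n : ℕ) (S : Finset K),
      HirschLE n ((⊤ : Subgroup K).lowerCentralSeries (i + 1)) →
      closure (S : Set K) ≤ (⊤ : Subgroup K).lowerCentralSeries i →
      ∃ m, HirschLE m ((⊤ : Subgroup K).lowerCentralSeries (i + 1) ⊔ closure (S : Set K)) := by
    classical
    intro i n S hn
    induction S using Finset.induction_on with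
    | empty => intro _; exact ⟨n, by simpa using hn⟩
    | insert a S _ ih =>
      intro hS
      rw [Finset.coe_insert, Set.insert_eq, Set.union_comm, Subgroup.closure_union,
        ← zpowers_eq_closure] at hS ⊢
      obtain ⟨m, hm⟩ := ih (le_sup_left.trans hS)
      have := normal_of_between_lowerCentralSeries le_sup_left
        (sup_le (Subgroup.lowerCentralSeries_antitone _ (Nat.le_succ i)) (le_sup_left.trans hS))
      exact ⟨m + 1, by rw [← sup_assoc]; exact hm.sup_zpowers a⟩
  have down : ∀ j ≤ c, ∃ n, HirschLE n ((⊤ : Subgroup K).lowerCentralSeries (c - j)) := by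
    intro j
    induction j with
    | zero => intro _; exact ⟨0, by rw [Nat.sub_zero, hc]; exact bot⟩
    | succ j ih =>
      intro hj
      obtain ⟨n, hn⟩ := ih (by omega)
      rw [show c - j = c - (j + 1) + 1 by omega] at hn
      obtain ⟨S, hS⟩ := exists_finset_lowerCentralSeries (Γ := K) (c - (j + 1))
      obtain ⟨m, hm⟩ := step _ n S hn (by rw [hS]; exact le_sup_right)
      exact ⟨m, by rw [hS]; exact hm⟩
  obtain ⟨n, hn⟩ := down c le_rfl
  rw [Nat.sub_self, Subgroup.lowerCentralSeries_zero] at hn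
  have h2 := hn.map K.subtype K.subtype_injective
  rw [← MonoidHom.range_eq_map, range_subtype] at h2
  exact ⟨n, finite h2 le_top (by rw [relIndex_top_right]; exact hfi.index_ne_zero)⟩

end Nilpotent

/-! ### A semigroup law excluding ping-pong -/

section Malcev

variable {Γ : Type} [Group Γ]

/-- The substitution `(x, y) ↦ (x y, y x)`. Iterating it produces two different positive words
that agree in nilpotent groups. -/
def malcev (p : Γ × Γ) : Γ × Γ := (p.1 * p.2, p.2 * p.1)

/-- Any two elements have powers on which some iterate of `malcev` yields two equal words. -/
def HasMalcevLaw (Γ : Type) [Group Γ] : Prop :=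
  ∀ x y : Γ, ∃ k l c : ℕ, k ≠ 0 ∧ l ≠ 0 ∧
    (malcev^[c] (x ^ k, y ^ l)).1 = (malcev^[c] (x ^ k, y ^ l)).2

theorem malcev_iterate_mem_lowerCentralSeries (K : Subgroup Γ) {x y : Γ} (hx : x ∈ K) (hy : y ∈ K)
    (c : ℕ) : (malcev^[c] (x, y)).1 ∈ K ∧
      (malcev^[c] (x, y)).1⁻¹ * (malcev^[c] (x, y)).2 ∈ K.lowerCentralSeries c := by
  induction c with
  | zero => exact ⟨hx, K.mul_mem (K.inv_mem hx) hy⟩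
  | succ c ih =>
    rw [Function.iterate_succ_apply']
    obtain ⟨h1, h2⟩ := ih
    generalize malcev^[c] (x, y) = p at h1 h2
    obtain ⟨a, b⟩ := p
    simp only [malcev] at *
    have hb : b ∈ K := by
      have := K.mul_mem h1 (K.lowerCentralSeries_antitone (Nat.zero_le c) h2)
      simpa using this
    refine ⟨K.mul_mem h1 hb, ?_⟩
    have h3 := Subgroup.commutator_mem_commutator (Subgroup.inv_mem _ h2) (K.inv_mem h1)
    have h4 : ⁅(a⁻¹ * b)⁻¹, a⁻¹⁆ = (a * b)⁻¹ * (b * a) := by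
      rw [commutatorElement_def]; group
    rwa [h4] at h3

theorem HasMalcevLaw.of_isVirtuallyNilpotent (h : Group.IsVirtuallyNilpotent Γ) :
    HasMalcevLaw Γ := by
  obtain ⟨K, hK, hfi⟩ := h
  obtain ⟨c, hc⟩ := (Subgroup.isNilpotent_iff_lowerCentralSeries K).1 hK
  intro x y
  obtain ⟨k, hk, -, hx⟩ := Subgroup.exists_pow_mem_of_index_ne_zero hfi.index_ne_zero x
  obtain ⟨l, hl, -, hy⟩ := Subgroup.exists_pow_mem_of_index_ne_zero hfi.index_ne_zero y
  refine ⟨k, l, c, hk.ne', hl.ne', ?_⟩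
  have := (malcev_iterate_mem_lowerCentralSeries K hx hy c).2
  rw [hc, Subgroup.mem_bot, inv_mul_eq_one] at this
  exact this

theorem HasMalcevLaw.of_central_ker {Δ : Type} [Group Δ] (f : Γ →* Δ) (h : HasMalcevLaw Δ)
    (hf : f.ker ≤ Subgroup.center Γ) : HasMalcevLaw Γ := by
  intro x y
  obtain ⟨k, l, c, hk, hl, he⟩ := h (f x) (f y)
  refine ⟨k, l, c + 1, hk, hl, ?_⟩
  have hit : ∀ c : ℕ, malcev^[c] (f x ^ k, f y ^ l) =
      (f (malcev^[c] (x ^ k, y ^ l)).1, f (malcev^[c] (x ^ k, y ^ l)).2) := by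
    intro c
    induction c with
    | zero => simp
    | succ c ih => rw [Function.iterate_succ_apply', ih, Function.iterate_succ_apply']; simp [malcev]
  rw [hit] at he
  rw [Function.iterate_succ_apply']
  generalize malcev^[c] (x ^ k, y ^ l) = p at he
  obtain ⟨a, b⟩ := p
  simp only [malcev] at *
  have hz : a⁻¹ * b ∈ Subgroup.center Γ := hf (by rw [MonoidHom.mem_ker, map_mul, map_inv, he]; simp)
  have := Subgroup.mem_center_iff.1 hz a
  calc a * b = a * (a * (a⁻¹ * b)) := by group
    _ = a * (a⁻¹ * b * a) := by rw [this]
    _ = b * a := by group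

/-- A group satisfying the law admits no ping-pong: two elements cannot map a set into two
disjoint subsets of it. -/
theorem HasMalcevLaw.not_pingPong (h : HasMalcevLaw Γ) {X : Type} [MulAction Γ X]
    {A B D : Set X} (hD : D.Nonempty) (hA : A ⊆ D) (hB : B ⊆ D) (hAB : Disjoint A B) (x y : Γ)
    (hx : ∀ d ∈ D, x • d ∈ A) (hy : ∀ d ∈ D, y • d ∈ B) : False := by
  obtain ⟨k, l, c, hk, hl, he⟩ := h x y
  have hpow : ∀ {z : Γ} {E : Set X}, E ⊆ D → (∀ d ∈ D, z • d ∈ E) → ∀ n ≠ 0, ∀ d ∈ D,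
      z ^ n • d ∈ E := by
    intro z E hE hz n hn
    induction n with
    | zero => exact absurd rfl hn
    | succ n ih =>
      intro d hd
      rw [pow_succ, mul_smul]
      rcases eq_or_ne n 0 with rfl | hn
      · simpa using hz d hd
      · exact ih hn _ (hE (hz d hd))
  have hit : ∀ c : ℕ, (∀ d ∈ D, (malcev^[c] (x ^ k, y ^ l)).1 • d ∈ A) ∧
      ∀ d ∈ D, (malcev^[c] (x ^ k, y ^ l)).2 • d ∈ B := by
    intro c
    induction c with
    | zero => exact ⟨hpow hA hx k hk, hpow hB hy l hl⟩
    | succ c ih =>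
      rw [Function.iterate_succ_apply']
      simp only [malcev, mul_smul]
      exact ⟨fun d hd => ih.1 _ (hB (ih.2 d hd)), fun d hd => ih.2 _ (hA (ih.1 d hd))⟩
  obtain ⟨d, hd⟩ := hD
  exact Set.disjoint_left.1 hAB ((hit c).1 d hd) (he ▸ (hit c).2 d hd)

end Malcev

/-! ### Order-preserving actions on the line -/

section OrderedAction

variable {Γ : Type} [Group Γ] {X : Type} [ConditionallyCompleteLinearOrder X] [MulAction Γ X]

theorem exists_pow_smul_lt (hmono : ∀ γ : Γ, StrictMono fun x : X => γ • x) {f : Γ} {b w : X}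
    (hb : f • b ≤ b) (hw : ∀ z ∈ Set.Icc w b, f • z ≠ z) : ∃ n : ℕ, f ^ n • b < w := by
  by_contra! hcon
  have hbdd : BddBelow (Set.range fun n : ℕ => f ^ n • b) := ⟨w, by rintro _ ⟨n, rfl⟩; exact hcon n⟩
  set s := ⨅ n : ℕ, f ^ n • b with hs
  have hle : ∀ n : ℕ, s ≤ f ^ n • b := fun n => ciInf_le hbdd n
  refine hw s ⟨le_ciInf hcon, by simpa using hle 0⟩ (le_antisymm ?_ ?_)
  · refine le_ciInf fun n => ?_
    calc f • s ≤ f • f ^ n • b := (hmono f).monotone (hle n)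
      _ = f ^ n • f • b := by rw [← mul_smul, ← mul_smul, ← pow_succ, ← pow_succ']
      _ ≤ f ^ n • b := (hmono _).monotone hb
  · have h1 : f⁻¹ • s ≤ s := by
      refine le_ciInf fun n => ?_
      have := (hmono f⁻¹).monotone (hle (n + 1))
      simpa only [pow_succ', mul_smul, inv_smul_smul] using this
    simpa only [smul_inv_smul] using (hmono f).monotone h1

theorem exists_last_fixed (hmono : ∀ γ : Γ, StrictMono fun x : X => γ • x) {f : Γ} {p x : X}
    (hp : f • p = p) (hpx : p < x) (hx : f • x ≠ x) :
    ∃ a ∈ Set.Ico p x, f • a = a ∧ ∀ z ∈ Set.Ioc a x, f • z ≠ z := by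
  set S := {z | z ∈ Set.Icc p x ∧ f • z = z} with hS
  have hne : S.Nonempty := ⟨p, ⟨le_rfl, hpx.le⟩, hp⟩
  have hbdd : BddAbove S := ⟨x, fun z hz => hz.1.2⟩
  have hle : ∀ g : Γ, (∀ z ∈ S, g • z = z) → sSup S ≤ g • sSup S := by
    intro g hg
    refine csSup_le hne fun z hz => ?_
    rw [← hg z hz]
    exact (hmono g).monotone (le_csSup hbdd hz)
  have hfix : f • sSup S = sSup S := by
    refine le_antisymm ?_ (hle f fun z hz => hz.2)
    have := hle f⁻¹ fun z hz => by rw [inv_smul_eq_iff, hz.2]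
    simpa only [smul_inv_smul] using (hmono f).monotone this
  have hlt : sSup S < x := lt_of_le_of_ne (csSup_le hne fun z hz => hz.1.2)
    fun h => hx (by rwa [h] at hfix)
  refine ⟨sSup S, ⟨le_csSup hbdd ⟨⟨le_rfl, hpx.le⟩, hp⟩, hlt⟩, hfix, fun z hz hfz => ?_⟩
  exact hz.1.not_ge (le_csSup hbdd
    ⟨⟨(le_csSup hbdd ⟨⟨le_rfl, hpx.le⟩, hp⟩).trans hz.1.le, hz.2⟩, hfz⟩)

theorem smul_csSup_eq (hmono : ∀ γ : Γ, StrictMono fun x : X => γ • x) {J : Set X}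
    (hne : J.Nonempty) (hbdd : BddAbove J) {γ : Γ} (hγ : γ • J = J) :
    γ • sSup J = sSup J := by
  have hle : ∀ g : Γ, g • J = J → sSup J ≤ g • sSup J := by
    intro g hg
    refine csSup_le hne fun z hz => ?_
    rw [← hg] at hz
    obtain ⟨y, hy, rfl⟩ := hz
    exact (hmono g).monotone (le_csSup hbdd hy)
  refine le_antisymm ?_ (hle γ hγ)
  have := hle γ⁻¹ (by rw [inv_smul_eq_iff, hγ])
  simpa only [smul_inv_smul] using (hmono γ).monotone this

/-- If `f` has no fixed point in `(a, b]` but fixes `a`, no element maps `a` to `b`: a power of `f`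
contracting towards `a`, and its composition with that element, would play ping-pong. -/
theorem HasMalcevLaw.not_linked [DenselyOrdered X] (hlaw : HasMalcevLaw Γ)
    (hmono : ∀ γ : Γ, StrictMono fun x : X => γ • x) {f h : Γ} {a : X} (hfa : f • a = a)
    (hab : a < h • a) (hfix : ∀ z ∈ Set.Ioc a (h • a), f • z ≠ z) : False := by
  wlog hb : f • h • a < h • a generalizing f
  · refine this (f := f⁻¹) (by rw [inv_smul_eq_iff, hfa]) (fun z hz h => hfix z hz ?_) ?_
    · rw [inv_smul_eq_iff] at h; exact h.symm
    · have h1 : h • a < f • h • a :=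
        lt_of_le_of_ne (not_lt.1 hb) (hfix _ ⟨hab, le_rfl⟩).symm
      simpa only [inv_smul_smul] using hmono f⁻¹ h1
  have h1 : a < h⁻¹ • f⁻¹ • h • a := by
    have := hmono h⁻¹ (hmono f⁻¹ hb)
    simpa only [inv_smul_smul] using this
  obtain ⟨a', ha, ha'⟩ := exists_between (lt_min hab h1)
  have hfa' : f • h • a' < h • a := by
    have := hmono f (hmono h (ha'.trans_le (min_le_right _ _)))
    simpa only [smul_inv_smul] using this
  obtain ⟨n, hn⟩ := exists_pow_smul_lt hmono hb.le (w := a')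
    fun z hz => hfix z ⟨ha.trans_le hz.1, hz.2⟩
  have hpa : f ^ (n + 1) • a = a := (MulAction.stabilizer Γ a).pow_mem hfa (n + 1)
  have hlt : a' < h • a := ha'.trans_le (min_le_left _ _)
  have hx : ∀ d ∈ Set.Icc a (h • a'), f ^ (n + 1) • d ∈ Set.Icc a a' := by
    intro d hd
    constructor
    · rw [← hpa]; exact (hmono _).monotone hd.1
    · calc f ^ (n + 1) • d ≤ f ^ (n + 1) • h • a' := (hmono _).monotone hd.2
        _ = f ^ n • f • h • a' := by rw [pow_succ, mul_smul]
        _ ≤ f ^ n • h • a := (hmono _).monotone hfa'.le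
        _ ≤ a' := hn.le
  have hha : h • a ≤ h • a' := (hmono h).monotone ha.le
  refine hlaw.not_pingPong (D := Set.Icc a (h • a')) (A := Set.Icc a a')
    (B := Set.Icc (h • a) (h • a')) ⟨a, le_rfl, hab.le.trans hha⟩
    (Set.Icc_subset_Icc_right (hlt.le.trans hha)) (Set.Icc_subset_Icc_left hab.le)
    (Set.disjoint_left.2 fun z hz hz' => (hz.2.trans_lt hlt).not_ge hz'.1)
    (f ^ (n + 1)) (h * f ^ (n + 1)) hx fun d hd => ?_
  rw [mul_smul]
  exact ⟨(hmono h).monotone (hx d hd).1, (hmono h).monotone (hx d hd).2⟩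

theorem HasMalcevLaw.fixed_above [DenselyOrdered X] [TopologicalSpace X] [OrderTopology X]
    (hlaw : HasMalcevLaw Γ) (hmono : ∀ γ : Γ, StrictMono fun x : X => γ • x) {J : Set X}
    (hJ : J.OrdConnected) (hmin : ∀ x ∈ J, J ⊆ closure {y | ∃ γ : Γ, γ • J = J ∧ γ • x = y})
    {f : Γ} {p x : X} (hp : p ∈ J) (hx : x ∈ J) (hpx : p < x) (hfp : f • p = p) : f • x = x := by
  by_contra hfx
  obtain ⟨a, ha, hfa, hfix⟩ := exists_last_fixed hmono hfp hpx hfx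
  have haJ : a ∈ J := hJ.out hp hx ⟨ha.1, ha.2.le⟩
  obtain ⟨m, hm⟩ := exists_between ha.2
  obtain ⟨_, hy, γ, -, rfl⟩ := mem_closure_iff.1
    (hmin a haJ (hJ.out haJ hx ⟨hm.1.le, hm.2.le⟩)) _ isOpen_Ioo hm
  exact hlaw.not_linked hmono hfa hy.1 fun z hz => hfix z ⟨hz.1, hz.2.trans hy.2.le⟩

/-- In a minimal action on an interval `J`, an element with a fixed point in `J` is trivial on `J`:
otherwise the orbit of an endpoint of a component of its support would enter that component. -/
theorem HasMalcevLaw.fixed_of_minimal [DenselyOrdered X] [TopologicalSpace X] [OrderTopology X]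
    (hlaw : HasMalcevLaw Γ) (hmono : ∀ γ : Γ, StrictMono fun x : X => γ • x) {J : Set X}
    (hJ : J.OrdConnected) (hmin : ∀ x ∈ J, J ⊆ closure {y | ∃ γ : Γ, γ • J = J ∧ γ • x = y})
    {f : Γ} {p x : X} (hp : p ∈ J) (hx : x ∈ J) (hfp : f • p = p) : f • x = x := by
  rcases lt_trichotomy p x with h | rfl | h
  · exact hlaw.fixed_above hmono hJ hmin hp hx h hfp
  · exact hfp
  · have hmono' : ∀ γ : Γ, StrictMono fun x : Xᵒᵈ => γ • x := fun γ _ _ h => hmono γ h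
    exact hlaw.fixed_above hmono' hJ.dual hmin hp hx h hfp

end OrderedAction

section Line

variable {Γ : Type} [Group Γ] [MulAction Γ ℝ]

theorem continuous_smul_of_strictMono (hmono : ∀ γ : Γ, StrictMono fun x : ℝ => γ • x) (γ : Γ) :
    Continuous fun x : ℝ => γ • x :=
  (hmono γ).monotone.continuous_of_surjective fun y => ⟨γ⁻¹ • y, smul_inv_smul γ y⟩

/-! ### Free actions with dense orbits are commutative -/

section Free

variable {H : Subgroup Γ} {J : Set ℝ}

theorem lt_smul_of_lt_smul (hmono : ∀ γ : Γ, StrictMono fun x : ℝ => γ • x) (hJ : J.OrdConnected)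
    (hfree : ∀ f ∈ H, ∀ p ∈ J, f • p = p → ∀ x ∈ J, f • x = x) {h k : Γ} (hh : h ∈ H) (hk : k ∈ H)
    {x y : ℝ} (hx : x ∈ J) (hy : y ∈ J) (hlt : h • x < k • x) : h • y < k • y := by
  by_contra! hle
  obtain ⟨p, hp, he⟩ := hJ.isPreconnected.intermediate_value₂ hx hy
    (continuous_smul_of_strictMono hmono h).continuousOn
    (continuous_smul_of_strictMono hmono k).continuousOn hlt.le hle
  have h1 := hfree (h⁻¹ * k) (H.mul_mem (H.inv_mem hh) hk) p hp
    (by rw [mul_smul, ← he, inv_smul_smul]) x hx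
  rw [mul_smul, inv_smul_eq_iff] at h1
  exact hlt.ne h1.symm

/-- A free order-preserving action on an interval is Archimedean. -/
theorem exists_zpow_smul_le_lt (hmono : ∀ γ : Γ, StrictMono fun x : ℝ => γ • x)
    (hJ : J.OrdConnected) (hHJ : ∀ f ∈ H, ∀ x ∈ J, f • x ∈ J)
    {ε f : Γ} (hε : ∀ x ∈ J, x < ε • x) (hf : f ∈ H)
    {x : ℝ} (hx : x ∈ J) : ∃ m : ℤ, ε ^ m • x ≤ f • x ∧ f • x < ε ^ (m + 1) • x := by
  have hinv : ∀ z ∈ J, ε⁻¹ • z < z := by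
    intro z hz
    simpa only [inv_smul_smul] using hmono ε⁻¹ (hε z hz)
  have hlow : ∃ n : ℕ, ε⁻¹ ^ n • x < f • x :=
    exists_pow_smul_lt hmono (hinv x hx).le fun z hz => (hinv z (hJ.out (hHJ f hf x hx) hx hz)).ne
  have hup : ∃ n : ℕ, f • x < ε ^ n • x :=
    exists_pow_smul_lt (X := ℝᵒᵈ) (fun γ _ _ h => hmono γ h) (hε x hx).le
      fun z hz => (hε z (hJ.out hx (hHJ f hf x hx) ⟨hz.2, hz.1⟩)).ne'
  obtain ⟨n, hn⟩ := hlow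
  obtain ⟨N, hN⟩ := hup
  have hmonoε : Monotone fun k : ℤ => ε ^ k • x := by
    refine monotone_int_of_le_succ fun k => ?_
    rw [zpow_add, zpow_one, mul_smul]
    exact (hmono _).monotone (hε x hx).le
  obtain ⟨m, hm, hmax⟩ := Int.exists_greatest_of_bdd (P := fun k : ℤ => ε ^ k • x ≤ f • x)
    ⟨N, fun z hz => by
      by_contra! hlt
      have := hmonoε hlt.le
      simp only [zpow_natCast] at this
      exact (hN.trans_le (this.trans hz)).false⟩
    ⟨-n, by simpa using hn.le⟩
  exact ⟨m, hm, lt_of_not_ge fun h => by have := hmax _ h; omega⟩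

/-- Hölder's argument: a free action with dense orbits is commutative, since otherwise a commutator
dominates the square of some small positive element `ε`, while comparing the factors with powers
of `ε` bounds it strictly by that square. -/
theorem smul_comm_of_free (hmono : ∀ γ : Γ, StrictMono fun x : ℝ => γ • x) (hJ : J.OrdConnected)
    (hHJ : ∀ f ∈ H, ∀ x ∈ J, f • x ∈ J)
    (hfree : ∀ f ∈ H, ∀ p ∈ J, f • p = p → ∀ x ∈ J, f • x = x)
    (hmin : ∀ x ∈ J, J ⊆ closure {y | ∃ γ ∈ H, γ • x = y})
    {f g : Γ} (hf : f ∈ H) (hg : g ∈ H) {x : ℝ} (hx : x ∈ J) : f • g • x = g • f • x := by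
  by_contra hne
  wlog hlt : g • f • x < f • g • x generalizing f g
  · exact this hg hf (Ne.symm hne) (lt_of_le_of_ne (not_lt.1 hlt) hne)
  have hcmp : ∀ {h k : Γ}, h ∈ H → k ∈ H → ∀ {x y : ℝ}, x ∈ J → y ∈ J → h • x < k • x →
      h • y < k • y := fun hh hk _ _ hx hy => lt_smul_of_lt_smul hmono hJ hfree hh hk hx hy
  set y := g • f • x with hy
  have hyJ : y ∈ J := hHJ g hg _ (hHJ f hf x hx)
  set c := f * g * f⁻¹ * g⁻¹ with hc
  have hcH : c ∈ H := H.mul_mem (H.mul_mem (H.mul_mem hf hg) (H.inv_mem hf)) (H.inv_mem hg)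
  have hcy : c • y = f • g • x := by simp [hc, hy, mul_smul]
  obtain ⟨w, hw1, hw2⟩ := exists_between hlt
  have hwJ : w ∈ J := hJ.out hyJ (hHJ f hf _ (hHJ g hg x hx)) ⟨hw1.le, hw2.le⟩
  obtain ⟨_, ⟨h1, h2⟩, e, heH, rfl⟩ := mem_closure_iff.1 (hmin y hyJ hwJ) _ isOpen_Ioo ⟨hw1, hw2⟩
  obtain ⟨ε, hεH, hε, hεc⟩ : ∃ ε ∈ H, y < ε • y ∧ ε • ε • y ≤ c • y := by
    rcases le_or_gt (e • e • y) (c • y) with h | h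
    · exact ⟨e, heH, h1, h⟩
    · have hεH : e⁻¹ * c ∈ H := H.mul_mem (H.inv_mem heH) hcH
      have h3 : y < (e⁻¹ * c) • y := by
        rw [mul_smul, hcy]
        simpa only [inv_smul_smul] using hmono e⁻¹ h2
      have h4 : (e⁻¹ * c) • y < e • y := by
        rw [mul_smul]
        simpa only [inv_smul_smul] using hmono e⁻¹ h
      refine ⟨e⁻¹ * c, hεH, h3, ?_⟩
      have := hcmp hεH heH hyJ (hHJ _ hεH _ hyJ) h4
      exact this.le.trans_eq (by rw [mul_smul, smul_inv_smul])
  have hε' : ∀ z ∈ J, z < ε • z := by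
    intro z hz
    have := hcmp H.one_mem hεH hyJ hz (by simpa using hε)
    simpa using this
  have hεpow : ∀ k : ℤ, ε ^ k ∈ H := fun k => H.zpow_mem hεH k
  obtain ⟨m, hm1, hm2⟩ := exists_zpow_smul_le_lt hmono hJ hHJ hε' hf hx
  obtain ⟨n, hn1, hn2⟩ := exists_zpow_smul_le_lt hmono hJ hHJ hε' hg hx
  have hlow : ε ^ (n + m) • x ≤ y := by
    rw [zpow_add, mul_smul, hy]
    refine ((hmono _).monotone hm1).trans ?_
    by_contra! hcon
    exact (hcmp hg (hεpow n) (hHJ f hf x hx) hx hcon).not_ge hn1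
  have hup : f • g • x < ε ^ (m + 1) • ε ^ (n + 1) • x :=
    (hcmp hf (hεpow _) hx (hHJ g hg x hx) hm2).trans (hmono _ hn2)
  have : ε ^ (m + 1) • ε ^ (n + 1) • x = ε • ε • ε ^ (n + m) • x := by
    simp only [← mul_smul, ← zpow_add]
    rw [← mul_assoc, ← sq, ← zpow_natCast, ← zpow_add]
    congr 2
    push_cast
    ring
  rw [this, ← hcy] at hup
  exact (hup.trans_le (((hmono ε).monotone ((hmono ε).monotone hlow)).trans hεc)).false

end Free

/-- A minimal action on an interval by a group with the Malcev law is commutative. -/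
theorem HasMalcevLaw.smul_comm_of_minimal (hlaw : HasMalcevLaw Γ)
    (hmono : ∀ γ : Γ, StrictMono fun x : ℝ => γ • x) {J : Set ℝ} (hJ : J.OrdConnected)
    (hmin : ∀ x ∈ J, J ⊆ closure {y | ∃ γ : Γ, γ • J = J ∧ γ • x = y})
    {f g : Γ} (hf : f • J = J) (hg : g • J = J) {x : ℝ} (hx : x ∈ J) :
    f • g • x = g • f • x :=
  smul_comm_of_free (H := MulAction.stabilizer Γ J) hmono hJ
    (fun h hh x hx => by rw [← MulAction.mem_stabilizer_iff.1 hh]; exact Set.smul_mem_smul_set hx)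
    (fun _ _ _ hp hfp _ hx => hlaw.fixed_of_minimal hmono hJ hmin hp hx hfp) hmin hf hg hx

/-! ### Existence of tame intervals -/

/-- An open interval of the line whose translates are equal or disjoint, and on which its
stabilizer acts either trivially or minimally and commutatively. -/
structure TameInterval (Γ : Type) [Group Γ] [MulAction Γ ℝ] (J : Set ℝ) : Prop where
  isOpen : IsOpen J
  ordConnected : J.OrdConnected
  nonempty : J.Nonempty
  isBlock : MulAction.IsBlock Γ J
  trivial_or_minimal : (∀ γ : Γ, γ • J = J → ∀ x ∈ J, γ • x = x) ∨
    ((∀ x ∈ J, J ⊆ closure {y | ∃ γ : Γ, γ • J = J ∧ γ • x = y}) ∧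
      ∀ γ δ : Γ, γ • J = J → δ • J = J → ∀ x ∈ J, γ • δ • x = δ • γ • x)

theorem smul_ordConnectedComponent (hmono : ∀ γ : Γ, StrictMono fun x : ℝ => γ • x) {V : Set ℝ}
    {x y : ℝ} {γ : Γ} (hγ : γ • V = V) (hy : y ∈ V.ordConnectedComponent x)
    (hγy : γ • y ∈ V.ordConnectedComponent x) :
    γ • V.ordConnectedComponent x = V.ordConnectedComponent x := by
  have hle : ∀ (g : Γ) (y : ℝ), g • V = V → y ∈ V.ordConnectedComponent x →
      g • y ∈ V.ordConnectedComponent x →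
      g • V.ordConnectedComponent x ⊆ V.ordConnectedComponent x := by
    rintro g y hg hy hgy _ ⟨z, hz, rfl⟩
    refine Set.mem_ordConnectedComponent_trans hgy ?_
    have hyz : Set.uIcc y z ⊆ V :=
      Set.mem_ordConnectedComponent_trans (Set.mem_ordConnectedComponent_comm.1 hy) hz
    intro w hw
    have hw' : g⁻¹ • w ∈ Set.uIcc y z := by
      rw [Set.mem_uIcc] at hw ⊢
      refine hw.imp (fun h => ?_) (fun h => ?_) <;>
      · have h1 := (hmono g⁻¹).monotone h.1
        have h2 := (hmono g⁻¹).monotone h.2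
        simp only [inv_smul_smul] at h1 h2
        exact ⟨h1, h2⟩
    have := Set.smul_mem_smul_set (a := g) (hyz hw')
    rwa [smul_inv_smul, hg] at this
  refine (hle γ y hγ hy hγy).antisymm ?_
  have := hle γ⁻¹ (γ • y) (by rw [inv_smul_eq_iff, hγ]) hγy (by rwa [inv_smul_smul])
  rwa [Set.smul_set_subset_iff_subset_inv_smul_set, inv_inv] at this

theorem isOpen_ordConnectedComponent {V : Set ℝ} (hV : IsOpen V) (x : ℝ) :
    IsOpen (V.ordConnectedComponent x) := by
  rw [isOpen_iff_mem_nhds]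
  intro y hy
  have hy' := hy
  rw [Set.mem_ordConnectedComponent] at hy'
  rw [Set.ordConnectedComponent_eq hy', Set.ordConnectedComponent_mem_nhds]
  exact hV.mem_nhds (hy' Set.right_mem_uIcc)

/-- The stabilizer of a block that is an interval is closed under taking roots. -/
theorem smul_eq_of_zpow_smul_eq (hmono : ∀ γ : Γ, StrictMono fun x : ℝ => γ • x) {J : Set ℝ}
    (hJ : J.OrdConnected) (hne : J.Nonempty) (hblock : MulAction.IsBlock Γ J) {f : Γ} {k : ℤ}
    (hk : k ≠ 0) (hf : f ^ k • J = J) : f • J = J := by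
  obtain ⟨n, hn⟩ : ∃ n : ℕ, f ^ (n + 1) • J = J := by
    have h1 : f ^ k.natAbs • J = J := by
      rcases Int.natAbs_eq k with h | h
      · rwa [h, zpow_natCast] at hf
      · rw [h, zpow_neg, zpow_natCast, inv_smul_eq_iff] at hf
        exact hf.symm
    exact ⟨k.natAbs - 1, by rwa [Nat.sub_add_cancel (by omega)]⟩
  obtain ⟨x, hx⟩ := hne
  have hxn : f ^ (n + 1) • x ∈ J := by rw [← hn]; exact Set.smul_mem_smul_set hx
  have hx' : f • x ∈ J := by
    rcases le_total x (f • x) with h | h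
    · refine hJ.out hx hxn ⟨h, ?_⟩
      have : Monotone fun k : ℕ => f ^ k • x := monotone_nat_of_le_succ fun k => by
        rw [pow_succ, mul_smul]; exact (hmono _).monotone h
      simpa using this (show 1 ≤ n + 1 by omega)
    · refine hJ.out hxn hx ⟨?_, h⟩
      have : Antitone fun k : ℕ => f ^ k • x := antitone_nat_of_succ_le fun k => by
        rw [pow_succ, mul_smul]; exact (hmono _).monotone h
      simpa using this (show 1 ≤ n + 1 by omega)
  exact MulAction.isBlock_iff_smul_eq_of_mem.1 hblock hx hx'

/-- Every interval block contains a tame interval, by induction on the Hirsch length of the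
stabilizer. Unless the stabilizer acts trivially or minimally on an interval between two of its
fixed points, a gap of an orbit closure there is a block whose stabilizer has smaller Hirsch
length. -/
theorem exists_tameInterval_of_isBlock (hlaw : HasMalcevLaw Γ)
    (hmono : ∀ γ : Γ, StrictMono fun x : ℝ => γ • x) (n : ℕ) :
    ∀ J : Set ℝ, IsOpen J → J.OrdConnected → J.Nonempty → MulAction.IsBlock Γ J →
      HirschLE n (MulAction.stabilizer Γ J) → ∃ J' ⊆ J, TameInterval Γ J' := by
  have hcc : ContinuousConstSMul Γ ℝ := ⟨continuous_smul_of_strictMono hmono⟩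
  induction n using Nat.strong_induction_on with
  | _ n ih =>
  intro J hJo hJc hJn hJb hn
  by_cases htriv : ∀ γ : Γ, γ • J = J → ∀ x ∈ J, γ • x = x
  · exact ⟨J, subset_rfl, hJo, hJc, hJn, hJb, Or.inl htriv⟩
  push Not at htriv
  obtain ⟨γ₀, hγ₀, x₀, hx₀, hne₀⟩ := htriv
  have hinvJ : ∀ {γ : Γ}, γ • J = J → ∀ {x}, x ∈ J → γ • x ∈ J := fun {γ} hγ {x} hx => by
    rw [← hγ]; exact Set.smul_mem_smul_set hx
  have hinv : ∀ {γ : Γ} {S : Set ℝ}, γ • S = S → γ⁻¹ • S = S := fun h => by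
    rw [inv_smul_eq_iff, h]
  -- the part of `J` moved by the stabilizer
  set V₀ : Set ℝ := J ∩ ⋃ γ ∈ {γ : Γ | γ • J = J}, {x | γ • x ≠ x} with hV₀
  have hmem₀ : ∀ {x}, x ∈ V₀ ↔ x ∈ J ∧ ∃ γ : Γ, γ • J = J ∧ γ • x ≠ x := by
    intro x; simp [hV₀]
  have hV₀o : IsOpen V₀ := hJo.inter (isOpen_biUnion fun γ _ =>
    isOpen_ne_fun (continuous_smul_of_strictMono hmono γ) continuous_id)
  have hxV₀ : x₀ ∈ V₀ := hmem₀.2 ⟨hx₀, γ₀, hγ₀, hne₀⟩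
  have hV₀s : ∀ {γ : Γ}, γ • J = J → γ • V₀ = V₀ := by
    have hle : ∀ {γ : Γ}, γ • J = J → γ • V₀ ⊆ V₀ := by
      rintro γ hγ _ ⟨x, hx, rfl⟩
      obtain ⟨hxJ, δ, hδ, hδx⟩ := hmem₀.1 hx
      refine hmem₀.2 ⟨hinvJ hγ hxJ, γ * δ * γ⁻¹, ?_, ?_⟩
      · rw [mul_smul, mul_smul, hinv hγ, hδ, hγ]
      · simpa [mul_smul] using hδx
    intro γ hγ
    refine (hle hγ).antisymm ?_
    have := hle (hinv hγ)
    rwa [Set.smul_set_subset_iff_subset_inv_smul_set, inv_inv] at this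
  set J₁ := V₀.ordConnectedComponent x₀ with hJ₁
  have hJ₁c : J₁.OrdConnected := inferInstance
  have hJ₁o : IsOpen J₁ := isOpen_ordConnectedComponent hV₀o x₀
  have hxJ₁ : x₀ ∈ J₁ := Set.self_mem_ordConnectedComponent.2 hxV₀
  have hJ₁V : J₁ ⊆ V₀ := Set.ordConnectedComponent_subset
  have hJ₁J : J₁ ⊆ J := fun x hx => (hmem₀.1 (hJ₁V hx)).1
  have hJ₁s : ∀ {γ : Γ}, γ • J = J → γ • J₁ = J₁ := by
    intro γ hγ
    refine smul_ordConnectedComponent hmono (hV₀s hγ) hxJ₁ fun z hz => ?_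
    refine hmem₀.2 ⟨hJc.uIcc_subset hx₀ (hinvJ hγ hx₀) hz, ?_⟩
    by_contra! hfix
    have hz' : x₀ ≠ z := fun h => by
      subst h
      exact hne₀ (hfix _ hγ₀)
    have hzγ := hfix _ hγ
    rcases Set.mem_uIcc.1 hz with h | h
    · exact (hmono γ (lt_of_le_of_ne h.1 hz')).not_ge (hzγ.trans_le h.2)
    · exact (hmono γ (lt_of_le_of_ne h.2 hz'.symm)).not_ge (h.1.trans_eq hzγ.symm)
  have hJ₁b : MulAction.IsBlock Γ J₁ := MulAction.isBlock_iff_smul_eq_of_mem.2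
    fun γ x hx hγx => hJ₁s (MulAction.isBlock_iff_smul_eq_of_mem.1 hJb (hJ₁J hx) (hJ₁J hγx))
  have hJ₁J' : ∀ {γ : Γ}, γ • J₁ = J₁ → γ • J = J := fun {γ} h =>
    MulAction.isBlock_iff_smul_eq_of_mem.1 hJb hx₀
      (hJ₁J (by rw [← h]; exact Set.smul_mem_smul_set hxJ₁))
  by_cases hmin : ∀ x ∈ J₁, J₁ ⊆ closure {y | ∃ γ : Γ, γ • J₁ = J₁ ∧ γ • x = y}
  · exact ⟨J₁, hJ₁J, hJ₁o, hJ₁c, ⟨x₀, hxJ₁⟩, hJ₁b, Or.inr ⟨hmin, fun γ δ hγ hδ x hx =>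
      hlaw.smul_comm_of_minimal hmono hJ₁c hmin hγ hδ hx⟩⟩
  push Not at hmin
  obtain ⟨y, hy, hnsub⟩ := hmin
  obtain ⟨x, hx, hxcl⟩ := Set.not_subset.1 hnsub
  set O : Set ℝ := {z | ∃ γ : Γ, γ • J₁ = J₁ ∧ γ • y = z} with hO
  have hOs : ∀ {γ : Γ}, γ • J₁ = J₁ → γ • O = O := by
    intro γ hγ
    ext z
    rw [Set.mem_smul_set_iff_inv_smul_mem]
    constructor
    · rintro ⟨δ, hδ, h⟩
      exact ⟨γ * δ, by rw [mul_smul, hδ, hγ], by rw [mul_smul, h, smul_inv_smul]⟩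
    · rintro ⟨δ, hδ, h⟩
      exact ⟨γ⁻¹ * δ, by rw [mul_smul, hδ, hinv hγ], by rw [mul_smul, h]⟩
  set V := J₁ \ closure O with hV
  have hVs : ∀ {γ : Γ}, γ • J₁ = J₁ → γ • V = V := by
    intro γ hγ
    rw [hV, Set.smul_set_sdiff, ← closure_smul, hγ, hOs hγ]
  have hVo : IsOpen V := hJ₁o.sdiff isClosed_closure
  set J' := V.ordConnectedComponent x with hJ'
  have hxJ' : x ∈ J' := Set.self_mem_ordConnectedComponent.2 ⟨hx, hxcl⟩
  have hJ'V : J' ⊆ V := Set.ordConnectedComponent_subset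
  have hJ'c : J'.OrdConnected := inferInstance
  have hJ'J₁ : J' ⊆ J₁ := hJ'V.trans Set.sdiff_subset
  have hyJ' : y ∉ J' := fun h => (hJ'V h).2 (subset_closure ⟨1, one_smul _ _, one_smul _ _⟩)
  have hJ'b : MulAction.IsBlock Γ J' := MulAction.isBlock_iff_smul_eq_of_mem.2
    fun γ z hz hγz => smul_ordConnectedComponent hmono
      (hVs (MulAction.isBlock_iff_smul_eq_of_mem.1 hJ₁b (hJ'J₁ hz) (hJ'J₁ hγz))) hz hγz
  have hstab : MulAction.stabilizer Γ J' ≤ MulAction.stabilizer Γ J := fun γ hγ =>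
    MulAction.isBlock_iff_smul_eq_of_mem.1 hJb (hJ₁J hx) (hJ₁J (hJ'J₁ (by
      rw [← MulAction.mem_stabilizer_iff.1 hγ]; exact Set.smul_mem_smul_set hxJ')))
  -- a common fixed point in `J₁` would be an endpoint of `J'`
  have hproper : MulAction.stabilizer Γ J' ≠ MulAction.stabilizer Γ J := by
    intro heq
    have hall : ∀ γ : Γ, γ • J = J → γ • J' = J' := fun γ hγ =>
      MulAction.mem_stabilizer_iff.1 (heq ▸ MulAction.mem_stabilizer_iff.2 hγ)
    obtain ⟨s, hs, hfix⟩ : ∃ s ∈ J₁, ∀ γ : Γ, γ • J = J → γ • s = s := by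
      rcases le_total x y with hxy | hxy
      · have hub : ∀ z ∈ J', z ≤ y := fun z hz => by
          by_contra! h
          exact hyJ' (hJ'c.out hxJ' hz ⟨hxy, h.le⟩)
        exact ⟨sSup J', hJ₁c.out hx hy ⟨le_csSup ⟨y, hub⟩ hxJ', csSup_le ⟨x, hxJ'⟩ hub⟩,
          fun γ hγ => smul_csSup_eq hmono ⟨x, hxJ'⟩ ⟨y, hub⟩ (hall γ hγ)⟩
      · have hlb : ∀ z ∈ J', y ≤ z := fun z hz => by
          by_contra! h
          exact hyJ' (hJ'c.out hz hxJ' ⟨h.le, hxy⟩)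
        exact ⟨sInf J', hJ₁c.out hy hx ⟨le_csInf ⟨x, hxJ'⟩ hlb, csInf_le ⟨y, hlb⟩ hxJ'⟩,
          fun γ hγ => smul_csSup_eq (X := ℝᵒᵈ) (fun γ _ _ h => hmono γ h) ⟨x, hxJ'⟩ ⟨y, hlb⟩
            (hall γ hγ)⟩
    obtain ⟨-, γ, hγ, hγs⟩ := hmem₀.1 (hJ₁V hs)
    exact hγs (hfix γ hγ)
  obtain ⟨m, hm, hmJ'⟩ := hn.exists_lt_of_isolated hstab hproper fun f _ k hk hfk =>
    smul_eq_of_zpow_smul_eq hmono hJ'c ⟨x, hxJ'⟩ hJ'b hk hfk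
  obtain ⟨K, hK, hKt⟩ := ih m hm J' (isOpen_ordConnectedComponent hVo x) hJ'c ⟨x, hxJ'⟩ hJ'b hmJ'
  exact ⟨K, hK.trans (hJ'J₁.trans hJ₁J), hKt⟩

/-- Every non-empty invariant open set contains a tame interval. -/
theorem exists_tameInterval_subset (hlaw : HasMalcevLaw Γ)
    (hmono : ∀ γ : Γ, StrictMono fun x : ℝ => γ • x) {n : ℕ} (hn : HirschLE n (⊤ : Subgroup Γ))
    {U : Set ℝ} (hU : IsOpen U) (hne : U.Nonempty) (hinv : ∀ γ : Γ, γ • U = U) :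
    ∃ J ⊆ U, TameInterval Γ J := by
  obtain ⟨x, hx⟩ := hne
  obtain ⟨J, hJ, ht⟩ := exists_tameInterval_of_isBlock hlaw hmono n (U.ordConnectedComponent x)
    (isOpen_ordConnectedComponent hU x) inferInstance
    ⟨x, Set.self_mem_ordConnectedComponent.2 hx⟩
    (MulAction.isBlock_iff_smul_eq_of_mem.2 fun γ _ hz hγz =>
      smul_ordConnectedComponent hmono (hinv γ) hz hγz)
    (hn.of_le le_top)
  exact ⟨J, hJ.trans Set.ordConnectedComponent_subset, ht⟩

end Line

/-! ### From tame intervals to decompositions -/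

section Assembly

variable {M : Type} [TopologicalSpace M]

/-- A set that can be one of the `I i` or one of the `N k` of a decomposition. -/
structure IsTameSet (G : Subgroup (M ≃ₜ M)) (W : Set M) : Prop where
  isOpen : IsOpen W
  nonempty : W.Nonempty
  invariant : IsInvariantSet G W
  intervals_or_minimal : ((∀ C, IsComponentOf C W → IsOpenInterval C) ∧
      (∀ C C', IsComponentOf C W → IsComponentOf C' W → ∃ g ∈ G, g '' C = C') ∧
      ∀ C, IsComponentOf C W → ∀ g ∈ G, g '' C = C → ∀ x ∈ C, g x = x) ∨
    (ActsMinimallyOn G W ∧ ∀ C, IsComponentOf C W → StabilizerActsAbelianly G C)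

/-- A maximal disjoint family of tame sets is a decomposition if tame sets are found in every
invariant open set. -/
theorem hasDecomposition_of_exists_isTameSet [TopologicalSpace.SeparableSpace M]
    (G : Subgroup (M ≃ₜ M))
    (h : ∀ U : Set M, IsOpen U → U.Nonempty → IsInvariantSet G U → ∃ W ⊆ U, IsTameSet G W) :
    HasDecomposition G := by
  classical
  obtain ⟨F, hF⟩ := zorn_subset {F : Set (Set M) | (∀ W ∈ F, IsTameSet G W) ∧
      F.PairwiseDisjoint id} (by
    intro c hc hchain
    refine ⟨⋃₀ c, ⟨?_, ?_⟩, fun s hs => Set.subset_sUnion_of_mem hs⟩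
    · rintro W ⟨s, hs, hW⟩
      exact (hc hs).1 W hW
    · exact (Set.pairwiseDisjoint_sUnion hchain.directedOn).2 fun s hs => (hc hs).2)
  obtain ⟨⟨hFt, hFd⟩, hmax⟩ := hF
  have hcount : F.Countable :=
    hFd.countable_of_isOpen (fun W hW => (hFt W hW).isOpen) fun W hW => (hFt W hW).nonempty
  have hdense : Dense (⋃₀ F) := by
    by_contra hnd
    rw [dense_iff_closure_eq, ← Ne, Set.ne_univ_iff_exists_notMem] at hnd
    obtain ⟨x, hx⟩ := hnd
    have hinv : IsInvariantSet G (⋃₀ F) := by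
      intro g hg
      rw [Set.sUnion_eq_biUnion, Set.image_iUnion₂]
      exact Set.iUnion₂_congr fun W hW => (hFt W hW).invariant g hg
    obtain ⟨W, hWU, hW⟩ := h (closure (⋃₀ F))ᶜ isClosed_closure.isOpen_compl ⟨x, hx⟩ (by
      intro g hg
      rw [Set.image_compl_eq g.bijective, g.image_closure, hinv g hg])
    have hdisj : ∀ V ∈ F, Disjoint W V := fun V hV =>
      Set.disjoint_left.2 fun y hy hyV => hWU hy (subset_closure ⟨V, hV, hyV⟩)
    have hWF : W ∈ F := hmax (y := insert W F)
      ⟨fun V hV => hV.elim (fun h => h ▸ hW) (hFt V),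
        hFd.insert fun V hV _ => hdisj V hV⟩ (Set.subset_insert W F) (Set.mem_insert W F)
    obtain ⟨y, hy⟩ := hW.nonempty
    exact Set.disjoint_left.1 (hdisj W hWF) hy hy
  have hFd' : ∀ V ∈ F, ∀ W ∈ F, V ≠ W → V ∩ W = ∅ := fun V hV W hW hne =>
    Set.disjoint_iff_inter_eq_empty.1 (hFd hV hW hne)
  let P : Set M → Prop := fun W => (∀ C, IsComponentOf C W → IsOpenInterval C) ∧
      (∀ C C', IsComponentOf C W → IsComponentOf C' W → ∃ g ∈ G, g '' C = C') ∧
      ∀ C, IsComponentOf C W → ∀ g ∈ G, g '' C = C → ∀ x ∈ C, g x = x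
  refine ⟨{W // W ∈ F ∧ P W}, {W // W ∈ F ∧ ¬ P W}, ?_, ?_, fun W => W.1, fun W => W.1, ?_⟩
  · exact (hcount.mono fun W hW => hW.1 : {W | W ∈ F ∧ P W}.Countable).to_subtype
  · exact (hcount.mono fun W hW => hW.1 : {W | W ∈ F ∧ ¬ P W}.Countable).to_subtype
  · have hN : ∀ W : {W // W ∈ F ∧ ¬ P W}, ActsMinimallyOn G W.1 ∧
        ∀ C, IsComponentOf C W.1 → StabilizerActsAbelianly G C := fun W =>
      (hFt W.1 W.2.1).intervals_or_minimal.resolve_left W.2.2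
    exact
    { isOpen_I := fun W => (hFt W.1 W.2.1).isOpen
      isOpen_N := fun W => (hFt W.1 W.2.1).isOpen
      nonempty_I := fun W => (hFt W.1 W.2.1).nonempty
      disjoint_I := fun V W hne => hFd' V.1 V.2.1 W.1 W.2.1 fun h => hne (Subtype.ext h)
      disjoint_N := fun V W hne => hFd' V.1 V.2.1 W.1 W.2.1 fun h => hne (Subtype.ext h)
      disjoint_I_N := fun V W => hFd' V.1 V.2.1 W.1 W.2.1 fun h => W.2.2 (h ▸ V.2.2)
      invariant_I := fun W => (hFt W.1 W.2.1).invariant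
      invariant_N := fun W => (hFt W.1 W.2.1).invariant
      interval_I := fun W => W.2.2.1
      transitive_I := fun W => W.2.2.2.1
      trivial_I := fun W => W.2.2.2.2
      minimal_N := fun W => (hN W).1
      abelian_N := fun W => (hN W).2
      dense_union := by
        refine hdense.mono ?_
        rintro x ⟨W, hW, hx⟩
        by_cases hP : P W
        · exact Or.inl (Set.mem_iUnion.2 ⟨⟨W, hW, hP⟩, hx⟩)
        · exact Or.inr (Set.mem_iUnion.2 ⟨⟨W, hW, hP⟩, hx⟩) }

theorem connectedComponentIn_iUnion_eq {ι : Type} {P : ι → Set M} (ho : ∀ i, IsOpen (P i))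
    (hc : ∀ i, IsPreconnected (P i)) (hd : ∀ i j, (P i ∩ P j).Nonempty → P i = P j)
    {i : ι} {x : M} (hx : x ∈ P i) : connectedComponentIn (⋃ j, P j) x = P i := by
  have hxU : x ∈ ⋃ j, P j := Set.mem_iUnion.2 ⟨i, hx⟩
  refine Set.Subset.antisymm ?_
    ((hc i).subset_connectedComponentIn hx (Set.subset_iUnion P i))
  have ho' : IsOpen (⋃ j ∈ {j | P j ≠ P i}, P j) := isOpen_biUnion fun j _ => ho j
  refine isPreconnected_connectedComponentIn.subset_left_of_subset_union (ho i) ho' ?_ ?_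
    ⟨x, mem_connectedComponentIn hxU, hx⟩
  · refine Set.disjoint_left.2 fun y hy hy' => ?_
    obtain ⟨j, hj, hyj⟩ := Set.mem_iUnion₂.1 hy'
    exact hj (hd j i ⟨y, hyj, hy⟩)
  · refine (connectedComponentIn_subset _ _).trans (Set.iUnion_subset fun j y hy => ?_)
    by_cases hj : P j = P i
    · exact Or.inl (hj ▸ hy)
    · exact Or.inr (Set.mem_iUnion₂.2 ⟨j, hj, hy⟩)

end Assembly

theorem nonempty_ball_homeomorph (c : ℝ) {r : ℝ} (hr : 0 < r) :
    Nonempty (Metric.ball c r ≃ₜ ℝ) := by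
  let e := (OpenPartialHomeomorph.univBall (E := ℝ) c r)
  have hs : e.source = Set.univ := OpenPartialHomeomorph.univBall_source c r
  have ht : e.target = Metric.ball c r := OpenPartialHomeomorph.univBall_target c hr
  exact ⟨(Homeomorph.setCongr ht.symm).trans
    (e.toHomeomorphSourceTarget.symm.trans
      ((Homeomorph.setCongr hs).trans (Homeomorph.Set.univ ℝ)))⟩

/-- Inside a tame interval with trivial stabilizer action, every ball is again tame. -/
theorem TameInterval.ball {Γ : Type} [Group Γ] [MulAction Γ ℝ] {J : Set ℝ} (hJ : TameInterval Γ J)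
    (htriv : ∀ γ : Γ, γ • J = J → ∀ x ∈ J, γ • x = x) {c r : ℝ} (hr : 0 < r)
    (hsub : Metric.ball c r ⊆ J) : TameInterval Γ (Metric.ball c r) ∧
      ∀ γ : Γ, γ • Metric.ball c r = Metric.ball c r → ∀ x ∈ Metric.ball c r, γ • x = x := by
  have hfix : ∀ γ : Γ, ∀ x ∈ Metric.ball c r, γ • x ∈ Metric.ball c r →
      ∀ y ∈ Metric.ball c r, γ • y = y := fun γ x hx hγx y hy =>
    htriv γ (MulAction.isBlock_iff_smul_eq_of_mem.1 hJ.isBlock (hsub hx) (hsub hγx)) y (hsub hy)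
  have htriv' : ∀ γ : Γ, γ • Metric.ball c r = Metric.ball c r →
      ∀ x ∈ Metric.ball c r, γ • x = x := fun γ hγ x hx =>
    hfix γ x hx (hγ ▸ Set.smul_mem_smul_set hx) x hx
  refine ⟨⟨Metric.isOpen_ball, ?_, ⟨c, Metric.mem_ball_self hr⟩, ?_, Or.inl htriv'⟩, htriv'⟩
  · rw [Real.ball_eq_Ioo]; exact Set.ordConnected_Ioo
  · refine MulAction.isBlock_iff_smul_eq_of_mem.2 fun γ x hx hγx => ?_
    have := hfix γ x hx hγx
    ext y
    constructor
    · rintro ⟨z, hz, rfl⟩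
      change γ • z ∈ _
      rwa [this z hz]
    · exact fun hy => ⟨y, hy, this y hy⟩

/-! ### Actions covered by the line -/

section Cover

variable {M : Type} [TopologicalSpace M]

/-- An action of `Γ` on the line covering the action of `G` on `M` through a map `π`, open with
dense range, whose fibres are orbits of elements acting trivially on `M`. -/
structure LineCover (G : Subgroup (M ≃ₜ M)) (Γ : Type) [Group Γ] [MulAction Γ ℝ]
    (q : Γ →* (M ≃ₜ M)) (π : ℝ → M) : Prop where
  range_eq : q.range = G
  strictMono : ∀ γ : Γ, StrictMono fun x : ℝ => γ • x
  continuous : Continuous π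
  isOpenMap : IsOpenMap π
  denseRange : DenseRange π
  equivariant : ∀ γ x, π (γ • x) = q γ (π x)
  fibre : ∀ x y, π x = π y → ∃ γ, q γ = 1 ∧ γ • x = y

namespace LineCover

variable {G : Subgroup (M ≃ₜ M)} {Γ : Type} [Group Γ] [MulAction Γ ℝ] {q : Γ →* (M ≃ₜ M)}
  {π : ℝ → M}

theorem mem (h : LineCover G Γ q π) (γ : Γ) : q γ ∈ G := h.range_eq ▸ ⟨γ, rfl⟩

/-- An element sending a point of `π '' J` to another can be lifted to one preserving `J`. -/
theorem exists_stabilizer (h : LineCover G Γ q π) {J : Set ℝ} (hJ : MulAction.IsBlock Γ J) {γ : Γ}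
    {a b : ℝ} (ha : a ∈ J) (hb : b ∈ J) (he : q γ (π a) = π b) :
    ∃ δ : Γ, q δ = q γ ∧ δ • J = J ∧ δ • a = b := by
  rw [← h.equivariant] at he
  obtain ⟨ε, hε, hab⟩ := h.fibre _ _ he
  rw [← mul_smul] at hab
  exact ⟨ε * γ, by rw [map_mul, hε, one_mul],
    MulAction.isBlock_iff_smul_eq_of_mem.1 hJ ha (hab ▸ hb), hab⟩

theorem image_eq (h : LineCover G Γ q π) {J : Set ℝ} {γ : Γ} (hγ : γ • J = J) :
    q γ '' (π '' J) = π '' J := by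
  conv_rhs => rw [← hγ]
  rw [← Set.image_smul, Set.image_image, Set.image_image]
  simp only [h.equivariant]

theorem image_eq_image (h : LineCover G Γ q π) {J : Set ℝ} (hJ : MulAction.IsBlock Γ J) {γ δ : Γ}
    (hne : (q γ '' (π '' J) ∩ q δ '' (π '' J)).Nonempty) :
    q γ '' (π '' J) = q δ '' (π '' J) := by
  obtain ⟨_, ⟨_, ⟨a, ha, rfl⟩, rfl⟩, ⟨_, ⟨b, hb, rfl⟩, hab⟩⟩ := hne
  obtain ⟨ε, hε, hεJ, -⟩ := h.exists_stabilizer hJ (γ := δ⁻¹ * γ) ha hb (by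
    rw [map_mul, map_inv]
    change (q δ).symm (q γ (π a)) = π b
    rw [← hab, Homeomorph.symm_apply_apply])
  have h1 := h.image_eq hεJ
  rw [hε] at h1
  conv_rhs => rw [← h1]
  rw [← Set.image_comp (q δ)]
  refine Set.image_congr fun z _ => ?_
  change q γ z = (q δ * q (δ⁻¹ * γ)) z
  rw [← map_mul, mul_inv_cancel_left]

/-- An element preserving a translate of `π '' J` lifts to an element preserving `J`. -/
theorem exists_stabilizer_of_image_eq (h : LineCover G Γ q π) {J : Set ℝ}
    (hJ : MulAction.IsBlock Γ J) (hne : J.Nonempty) {γ : Γ} {g : M ≃ₜ M} (hg : g ∈ G)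
    (hgC : g '' (q γ '' (π '' J)) = q γ '' (π '' J)) :
    ∃ ε : Γ, ε • J = J ∧ ∀ a, g (q γ (π a)) = q γ (π (ε • a)) := by
  obtain ⟨a, ha⟩ := hne
  rw [← h.range_eq] at hg
  obtain ⟨δ, rfl⟩ := hg
  have hmem : q δ (q γ (π a)) ∈ q γ '' (π '' J) := by
    rw [← hgC]; exact ⟨_, ⟨_, ⟨a, ha, rfl⟩, rfl⟩, rfl⟩
  obtain ⟨_, ⟨b, hb, rfl⟩, hab⟩ := hmem
  have hconj : ∀ z, q γ (q (γ⁻¹ * δ * γ) z) = q δ (q γ z) := by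
    intro z
    change (q γ * q (γ⁻¹ * δ * γ)) z = (q δ * q γ) z
    rw [← map_mul, ← map_mul]
    congr 2
    group
  obtain ⟨ε, hε, hεJ, -⟩ := h.exists_stabilizer hJ (γ := γ⁻¹ * δ * γ) ha hb
    ((q γ).injective (by rw [hconj, hab]))
  exact ⟨ε, hεJ, fun a => by rw [h.equivariant, hε, hconj]⟩

/-- The union of the translates of the image of a tame interval is a tame set. -/
theorem isTameSet (h : LineCover G Γ q π) {J : Set ℝ} (hJ : TameInterval Γ J)
    (hJhom : (∀ γ : Γ, γ • J = J → ∀ x ∈ J, γ • x = x) → Nonempty (J ≃ₜ ℝ)) :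
    IsTameSet G (⋃ γ : Γ, q γ '' (π '' J)) := by
  have hcomp : ∀ C, IsComponentOf C (⋃ γ : Γ, q γ '' (π '' J)) →
      ∃ γ : Γ, C = q γ '' (π '' J) := by
    rintro C ⟨x, hx, rfl⟩
    obtain ⟨γ, hγ⟩ := Set.mem_iUnion.1 hx
    refine ⟨γ, connectedComponentIn_iUnion_eq (P := fun γ : Γ => q γ '' (π '' J))
      (fun γ => (q γ).isOpenMap _ (h.isOpenMap _ hJ.isOpen)) (fun γ => ?_)
      (fun γ δ hne => h.image_eq_image hJ.isBlock hne) hγ⟩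
    exact (hJ.ordConnected.isPreconnected.image _ h.continuous.continuousOn).image _
      (q γ).continuous.continuousOn
  refine ⟨isOpen_iUnion fun γ => (q γ).isOpenMap _ (h.isOpenMap _ hJ.isOpen), ?_, ?_, ?_⟩
  · obtain ⟨a, ha⟩ := hJ.nonempty
    exact ⟨_, Set.mem_iUnion.2 ⟨1, _, ⟨a, ha, rfl⟩, rfl⟩⟩
  · intro g hg
    rw [← h.range_eq] at hg
    obtain ⟨δ, rfl⟩ := hg
    rw [Set.image_iUnion]
    have : ∀ γ : Γ, q δ '' (q γ '' (π '' J)) = q (δ * γ) '' (π '' J) := by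
      intro γ
      rw [← Set.image_comp, map_mul]
      rfl
    simp only [this]
    exact (Equiv.mulLeft δ).iSup_comp (g := fun γ : Γ => q γ '' (π '' J))
  rcases hJ.trivial_or_minimal with htriv | ⟨hmin, hab⟩
  · left
    refine ⟨fun C hC => ?_, fun C C' hC hC' => ?_, fun C hC g hg hgC x hx => ?_⟩
    · obtain ⟨γ, rfl⟩ := hcomp C hC
      refine ⟨(q γ).isOpenMap _ (h.isOpenMap _ hJ.isOpen), ?_⟩
      obtain ⟨e⟩ := hJhom htriv
      have hinj : Set.InjOn π J := by
        intro a ha b hb hπ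
        obtain ⟨δ, -, hδ, hδa⟩ := h.exists_stabilizer (γ := 1) hJ.isBlock ha hb
          (by rw [map_one]; exact hπ)
        rw [← hδa, htriv δ hδ a ha]
      have hemb : Topology.IsOpenEmbedding (J.domRestrict π) :=
        .of_continuous_injective_isOpenMap (h.continuous.comp continuous_subtype_val)
          (Set.injOn_iff_injective.1 hinj) (h.isOpenMap.comp hJ.isOpen.isOpenMap_subtype_val)
      have e1 : J ≃ₜ π '' J :=
        hemb.isEmbedding.toHomeomorph.trans (Homeomorph.setCongr (Set.range_domRestrict π J))
      exact ⟨((q γ).image (π '' J)).symm.trans (e1.symm.trans e)⟩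
    · obtain ⟨γ, rfl⟩ := hcomp C hC
      obtain ⟨δ, rfl⟩ := hcomp C' hC'
      refine ⟨q (δ * γ⁻¹), h.mem _, ?_⟩
      rw [← Set.image_comp]
      refine Set.image_congr fun z _ => ?_
      change (q (δ * γ⁻¹) * q γ) z = q δ z
      rw [← map_mul, inv_mul_cancel_right]
    · obtain ⟨γ, rfl⟩ := hcomp C hC
      obtain ⟨ε, hε, hgε⟩ := h.exists_stabilizer_of_image_eq hJ.isBlock hJ.nonempty hg hgC
      obtain ⟨_, ⟨a, ha, rfl⟩, rfl⟩ := hx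
      rw [hgε, htriv ε hε a ha]
  · right
    refine ⟨⟨?_, fun x hx y hy => ?_⟩, fun C hC g hg k hk hgC hkC x hx => ?_⟩
    · obtain ⟨a, ha⟩ := hJ.nonempty
      exact ⟨_, Set.mem_iUnion.2 ⟨1, _, ⟨a, ha, rfl⟩, rfl⟩⟩
    · obtain ⟨γ, _, ⟨a, ha, rfl⟩, rfl⟩ := Set.mem_iUnion.1 hx
      obtain ⟨δ, _, ⟨b, hb, rfl⟩, rfl⟩ := Set.mem_iUnion.1 hy
      refine map_mem_closure (f := fun z => q δ (π z)) ((q δ).continuous.comp h.continuous)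
        (hmin a ha hb) ?_
      rintro _ ⟨ε, -, rfl⟩
      refine ⟨q (δ * ε * γ⁻¹), h.mem _, ?_⟩
      beta_reduce
      rw [h.equivariant]
      change (q (δ * ε * γ⁻¹) * q γ) (π a) = (q δ * q ε) (π a)
      rw [← map_mul, ← map_mul, inv_mul_cancel_right]
    · obtain ⟨γ, rfl⟩ := hcomp C hC
      obtain ⟨ε, hε, hgε⟩ := h.exists_stabilizer_of_image_eq hJ.isBlock hJ.nonempty hg hgC
      obtain ⟨ε', hε', hkε⟩ := h.exists_stabilizer_of_image_eq hJ.isBlock hJ.nonempty hk hkC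
      obtain ⟨_, ⟨a, ha, rfl⟩, rfl⟩ := hx
      rw [hkε, hgε, hgε, hkε, hab ε ε' hε hε' a ha]

/-- The preimage of an invariant open set contains a tame interval, which projects to a tame set. -/
theorem hasDecomposition [TopologicalSpace.SeparableSpace M] (h : LineCover G Γ q π)
    (hlaw : HasMalcevLaw Γ) {n : ℕ} (hn : HirschLE n (⊤ : Subgroup Γ)) : HasDecomposition G := by
  refine hasDecomposition_of_exists_isTameSet G fun U hU hne hinv => ?_
  have hpre : ∀ γ : Γ, γ • π ⁻¹' U = π ⁻¹' U := by
    intro γ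
    ext x
    rw [Set.mem_smul_set_iff_inv_smul_mem, Set.mem_preimage, Set.mem_preimage, h.equivariant]
    conv_lhs => rw [← hinv _ (h.mem γ⁻¹)]
    exact (q γ⁻¹).injective.mem_set_image
  obtain ⟨x, hx⟩ := h.denseRange.exists_mem_open hU hne
  obtain ⟨J, hJU, hJ⟩ := exists_tameInterval_subset hlaw h.strictMono hn
    (hU.preimage h.continuous) ⟨x, hx⟩ hpre
  have hsub : ∀ K ⊆ J, (⋃ γ : Γ, q γ '' (π '' K)) ⊆ U := by
    intro K hK
    refine Set.iUnion_subset fun γ => ?_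
    rw [← hinv _ (h.mem γ)]
    exact Set.image_mono (Set.image_subset_iff.2 (hK.trans hJU))
  by_cases htriv : ∀ γ : Γ, γ • J = J → ∀ x ∈ J, γ • x = x
  · -- pass to a bounded subinterval, where a homeomorphism with the line is at hand
    obtain ⟨c, hc⟩ := hJ.nonempty
    obtain ⟨r, hr, hball⟩ := Metric.isOpen_iff.1 hJ.isOpen c hc
    exact ⟨_, hsub _ hball,
      h.isTameSet (hJ.ball htriv hr hball).1 fun _ => nonempty_ball_homeomorph c hr⟩
  · exact ⟨_, hsub J subset_rfl, h.isTameSet hJ fun h => absurd h htriv⟩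

/-- A minimal action on `M` lifts to a minimal action on the line, which is commutative. -/
theorem mul_comm_of_minimal [T2Space M] (h : LineCover G Γ q π) (hlaw : HasMalcevLaw Γ)
    (hmin : ActsMinimallyOn G Set.univ) : ∀ g ∈ G, ∀ k ∈ G, g * k = k * g := by
  have hmin' : ∀ x ∈ (Set.univ : Set ℝ), (Set.univ : Set ℝ) ⊆
      closure {y | ∃ γ : Γ, γ • (Set.univ : Set ℝ) = Set.univ ∧ γ • x = y} := by
    intro x _
    have hd : Dense {y | ∃ g ∈ G, g (π x) = y} := fun y => hmin.2 (π x) trivial trivial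
    refine fun y _ => closure_mono ?_ (hd.preimage h.isOpenMap y)
    rintro z ⟨g, hg, hgz⟩
    rw [← h.range_eq] at hg
    obtain ⟨γ, rfl⟩ := hg
    rw [← h.equivariant] at hgz
    obtain ⟨δ, -, hδ⟩ := h.fibre _ _ hgz
    exact ⟨δ * γ, Set.smul_set_univ, by rw [mul_smul, hδ]⟩
  intro g hg k hk
  rw [← h.range_eq] at hg hk
  obtain ⟨γ, rfl⟩ := hg
  obtain ⟨δ, rfl⟩ := hk
  have heq : ((q γ * q δ : M ≃ₜ M) : M → M) = (q δ * q γ : M ≃ₜ M) := by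
    refine h.denseRange.equalizer (q γ * q δ).continuous (q δ * q γ).continuous ?_
    ext x
    change q γ (q δ (π x)) = q δ (q γ (π x))
    simp only [← h.equivariant]
    rw [hlaw.smul_comm_of_minimal h.strictMono Set.ordConnected_univ hmin' Set.smul_set_univ
      Set.smul_set_univ (Set.mem_univ x)]
  exact DFunLike.coe_injective heq

end LineCover

/-- The group of pairs of an element of `G` and a lift of it to the line. -/
def liftGroup (G : Subgroup (M ≃ₜ M)) (π : ℝ → M) : Subgroup ((M ≃ₜ M) × (ℝ ≃o ℝ)) where
  carrier := {p | p.1 ∈ G ∧ ∀ x, π (p.2 x) = p.1 (π x)}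
  mul_mem' {p p'} hp hp' := ⟨G.mul_mem hp.1 hp'.1, fun x => (hp.2 _).trans (congrArg p.1 (hp'.2 x))⟩
  one_mem' := ⟨G.one_mem, fun _ => rfl⟩
  inv_mem' {p} hp := ⟨G.inv_mem hp.1, fun x => by
    refine p.1.injective ?_
    rw [← hp.2]
    change π (p.2 (p.2.symm x)) = p.1 (p.1.symm (π x))
    rw [OrderIso.apply_symm_apply, Homeomorph.apply_symm_apply]⟩

/-- The lift group acts on the line through the second component. -/
instance (G : Subgroup (M ≃ₜ M)) (π : ℝ → M) : MulAction (liftGroup G π) ℝ where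
  smul p x := p.1.2 x
  one_smul _ := rfl
  mul_smul _ _ _ := rfl

/-- If every element of `G` lifts to the line, and the lifts of the identity are the powers of a
single lift that commutes with all lifts, then finite generation and virtual nilpotency of `G` give
the lifted group the polycyclic structure and the semigroup law that the decomposition requires. -/
theorem hasDecomposition_of_lifts [TopologicalSpace.SeparableSpace M] [T2Space M]
    (G : Subgroup (M ≃ₜ M)) {π : ℝ → M} (hcont : Continuous π) (hopen : IsOpenMap π)
    (hdense : DenseRange π) (hlift : ∀ g ∈ G, ∃ F : ℝ ≃o ℝ, ∀ x, π (F x) = g (π x))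
    (τ : ℝ ≃o ℝ) (hτ : ∀ x, π (τ x) = π x)
    (hker : ∀ F : ℝ ≃o ℝ, (∀ x, π (F x) = π x) → ∃ k : ℤ, τ ^ k = F)
    (hfib : ∀ x y, π x = π y → ∃ k : ℤ, (τ ^ k) x = y)
    (hcomm : ∀ g ∈ G, ∀ F : ℝ ≃o ℝ, (∀ x, π (F x) = g (π x)) → F * τ = τ * F)
    (hfg : G.FG) (hvn : Group.IsVirtuallyNilpotent G) :
    HasDecomposition G ∧
      (ActsMinimallyOn G Set.univ → ∀ g ∈ G, ∀ h ∈ G, g * h = h * g) := by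
  let f : liftGroup G π →* G :=
    ((MonoidHom.fst _ _).comp (liftGroup G π).subtype).codRestrict G fun p => p.2.1
  have hf : Function.Surjective f := by
    rintro ⟨g, hg⟩
    obtain ⟨F, hF⟩ := hlift g hg
    exact ⟨⟨(g, F), hg, hF⟩, rfl⟩
  let t : liftGroup G π := ⟨(1, τ), G.one_mem, hτ⟩
  have hpow : ∀ k : ℤ, ((t ^ k : liftGroup G π) : (M ≃ₜ M) × (ℝ ≃o ℝ)) = (1, τ ^ k) := fun k => by
    rw [Subgroup.coe_zpow]
    change ((1 : M ≃ₜ M) ^ k, τ ^ k) = _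
    rw [one_zpow]
  have hfker : f.ker ≤ Subgroup.zpowers t := by
    intro p hp
    have hp1 : p.1.1 = 1 := congrArg Subtype.val (MonoidHom.mem_ker.1 hp)
    obtain ⟨k, hk⟩ := hker p.1.2 fun x => by rw [p.2.2, hp1]; rfl
    exact ⟨k, Subtype.ext ((hpow k).trans (Prod.ext hp1.symm hk))⟩
  have ht : t ∈ Subgroup.center (liftGroup G π) := by
    rw [Subgroup.mem_center_iff]
    intro p
    refine Subtype.ext (Prod.ext ?_ (hcomm _ p.2.1 _ p.2.2))
    change p.1.1 * 1 = 1 * p.1.1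
    rw [mul_one, one_mul]
  have : Group.FG G := (Group.fg_iff_subgroup_fg G).2 hfg
  have hlaw : HasMalcevLaw (liftGroup G π) :=
    (HasMalcevLaw.of_isVirtuallyNilpotent hvn).of_central_ker f
      (hfker.trans (by rwa [Subgroup.zpowers_le]))
  obtain ⟨n, hn⟩ := HirschLE.of_isVirtuallyNilpotent hvn
  have hn' : HirschLE (0 + 1 + n) (⊤ : Subgroup (liftGroup G π)) := by
    exact HirschLE.comap f hf
      ((HirschLE.bot.sup_zpowers t).of_le (hfker.trans le_sup_right)) hn
  have hcover : LineCover G (liftGroup G π) (G.subtype.comp f) π :=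
    { range_eq := by
        rw [MonoidHom.range_comp, MonoidHom.range_eq_top.2 hf, ← MonoidHom.range_eq_map,
          Subgroup.range_subtype]
      strictMono := fun p => p.1.2.strictMono
      continuous := hcont
      isOpenMap := hopen
      denseRange := hdense
      equivariant := fun p x => p.2.2 x
      fibre := fun x y hxy => by
        obtain ⟨k, hk⟩ := hfib x y hxy
        refine ⟨t ^ k, congrArg Prod.fst (hpow k), ?_⟩
        change (((t ^ k : liftGroup G π) : (M ≃ₜ M) × (ℝ ≃o ℝ)).2) x = y
        rw [hpow]
        exact hk }
  exact ⟨hcover.hasDecomposition hlaw hn', hcover.mul_comm_of_minimal hlaw⟩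

end Cover

/-! ### The four one-manifolds -/

section Models

/-- The case of an ordered manifold, `π` being an increasing parametrization of its interior. -/
theorem hasDecomposition_of_linearOrder {M : Type} [TopologicalSpace M] [LinearOrder M]
    [OrderTopology M] [TopologicalSpace.SeparableSpace M] {π : ℝ → M} (hπ : StrictMono π)
    (hrange : Set.range π = {x | ¬ IsMin x ∧ ¬ IsMax x}) (hopen : IsOpen (Set.range π))
    (hdense : DenseRange π) (G : Subgroup (M ≃ₜ M)) (hmono : ∀ g ∈ G, StrictMono g)
    (hfg : G.FG) (hvn : Group.IsVirtuallyNilpotent G) : HasDecomposition G := by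
  have hord : (Set.range π).OrdConnected := by
    rw [hrange]
    refine ⟨fun x hx y hy z hz => ⟨fun h => hx.1 fun w hw => ?_, fun h => hy.2 fun w hw => ?_⟩⟩
    · exact hz.1.trans (h (hw.trans hz.1))
    · exact (h (hz.2.trans hw)).trans hz.2
  have hemb : Topology.IsOpenEmbedding π := ⟨hπ.isEmbedding_of_ordConnected hord, hopen⟩
  have hmaps : ∀ g ∈ G, ∀ x, g (π x) ∈ Set.range π := by
    intro g hg x
    have hx : π x ∈ Set.range π := ⟨x, rfl⟩
    rw [hrange] at hx ⊢
    simp only [Set.mem_ofPred_eq, not_isMin_iff, not_isMax_iff] at hx ⊢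
    obtain ⟨⟨a, ha⟩, ⟨b, hb⟩⟩ := hx
    exact ⟨⟨g a, hmono g hg ha⟩, ⟨g b, hmono g hg hb⟩⟩
  refine (hasDecomposition_of_lifts G hemb.continuous hemb.isOpenMap hdense ?_ 1 (fun _ => rfl)
    (fun F hF => ⟨0, ?_⟩) (fun x y hxy => ⟨0, hπ.injective hxy⟩)
    (fun _ _ F _ => by rw [mul_one, one_mul]) hfg hvn).1
  · intro g hg
    choose F hF using hmaps g hg
    have hFm : StrictMono F := fun x y hxy => hπ.lt_iff_lt.1 (by
      rw [hF, hF]; exact hmono g hg (hπ hxy))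
    refine ⟨hFm.orderIsoOfSurjective F fun y => ?_, hF⟩
    obtain ⟨x, hx⟩ := hmaps g⁻¹ (G.inv_mem hg) y
    refine ⟨x, hπ.injective ?_⟩
    rw [hF, hx]
    exact g.apply_symm_apply _
  · ext x
    exact (hπ.injective (hF x)).symm

theorem coe_unitAddCircle_eq_iff {x y : ℝ} :
    (x : UnitAddCircle) = (y : UnitAddCircle) ↔ ∃ k : ℤ, x + k = y := by
  rw [QuotientAddGroup.eq, AddSubgroup.mem_zmultiples_iff]
  refine exists_congr fun k => ?_
  rw [zsmul_eq_mul, mul_one]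
  constructor <;> intro h <;> linarith

/-- An increasing lift of a homeomorphism of the circle has degree one. -/
theorem lift_add_one {g : UnitAddCircle ≃ₜ UnitAddCircle} {F : ℝ → ℝ} (hc : Continuous F)
    (hm : StrictMono F) (hF : ∀ x : ℝ, ((F x : ℝ) : UnitAddCircle) = g (x : UnitAddCircle))
    (x : ℝ) : F (x + 1) = F x + 1 := by
  obtain ⟨k, hk⟩ : ∃ k : ℤ, F x + k = F (x + 1) := by
    rw [← coe_unitAddCircle_eq_iff, hF, hF]
    exact congrArg g (coe_unitAddCircle_eq_iff.2 ⟨1, by simp⟩)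
  have hlt : F x < F (x + 1) := hm (lt_add_one x)
  have hk0 : 0 < k := by
    have : (0 : ℝ) < k := by linarith
    exact_mod_cast this
  rcases (show k = 1 ∨ 1 < k by omega) with rfl | hk1
  · rw [← hk]; simp
  · -- otherwise `g` would identify `x` with a point at distance less than one
    exfalso
    have hk1' : (1 : ℝ) < k := by exact_mod_cast hk1
    obtain ⟨y, ⟨hy1, hy2⟩, hy⟩ := intermediate_value_Ioo (lt_add_one x).le hc.continuousOn
      (show F x + 1 ∈ Set.Ioo (F x) (F (x + 1)) from ⟨by linarith, by linarith⟩)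
    have : (x : UnitAddCircle) = y := g.injective (by
      rw [← hF, ← hF, coe_unitAddCircle_eq_iff]
      exact ⟨1, by rw [hy]; simp⟩)
    obtain ⟨m, hm⟩ := coe_unitAddCircle_eq_iff.1 this
    have h1 : (0 : ℝ) < m := by linarith
    have h2 : (m : ℝ) < 1 := by linarith
    have h1' : 0 < m := by exact_mod_cast h1
    have h2' : m < 1 := by exact_mod_cast h2
    omega

theorem addRight_one_zpow (k : ℤ) (x : ℝ) : (OrderIso.addRight (1 : ℝ) ^ k) x = x + k := by
  induction k using Int.induction_on generalizing x with
  | zero => simp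
  | succ k ih =>
    rw [zpow_add_one, RelIso.mul_apply, ih]
    simp only [OrderIso.addRight_apply]
    push_cast
    ring
  | pred k ih =>
    rw [zpow_sub_one, RelIso.mul_apply, ih]
    change x + -1 + _ = _
    push_cast
    ring

theorem circle_structure (G : Subgroup (UnitAddCircle ≃ₜ UnitAddCircle))
    (hor : ∀ g ∈ G, CircleOrientationPreserving g) (hfg : G.FG)
    (hvn : Group.IsVirtuallyNilpotent G) : HasDecomposition G ∧
      (ActsMinimallyOn G Set.univ → ∀ g ∈ G, ∀ h ∈ G, g * h = h * g) := by
  have hadd : ∀ (g : UnitAddCircle ≃ₜ UnitAddCircle) (F : ℝ ≃o ℝ),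
      (∀ x : ℝ, ((F x : ℝ) : UnitAddCircle) = g (x : UnitAddCircle)) →
      F * OrderIso.addRight (1 : ℝ) = OrderIso.addRight (1 : ℝ) * F := by
    intro g F hF
    ext x
    exact lift_add_one F.continuous F.strictMono hF x
  refine hasDecomposition_of_lifts G (π := fun x : ℝ => (x : UnitAddCircle))
    (AddCircle.continuous_mk' 1) QuotientAddGroup.isOpenMap_coe
    (QuotientAddGroup.mk_surjective.denseRange) ?_ (OrderIso.addRight 1)
    (fun x => (coe_unitAddCircle_eq_iff.2 ⟨1, by simp⟩).symm) ?_ ?_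
    (fun g _ F hF => hadd g F hF) hfg hvn
  · intro g hg
    obtain ⟨F, hc, hm, hF⟩ := hor g hg
    have hnat : ∀ n : ℕ, F n = F 0 + n := by
      intro n
      induction n with
      | zero => simp
      | succ n ih => push_cast; rw [lift_add_one hc hm hF, ih]; ring
    have hneg : ∀ n : ℕ, F (-n) = F 0 - n := by
      intro n
      induction n with
      | zero => simp
      | succ n ih =>
        have := lift_add_one hc hm hF (-((n + 1 : ℕ) : ℝ))
        rw [show -((n + 1 : ℕ) : ℝ) + 1 = -(n : ℝ) by push_cast; ring, ih] at this
        push_cast at this ⊢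
        linarith
    have hs : Function.Surjective F := by
      intro y
      obtain ⟨n, hn⟩ := exists_nat_ge |y - F 0|
      have h1 := abs_le.1 hn
      obtain ⟨x, -, hx⟩ := intermediate_value_Icc
        (show -(n : ℝ) ≤ n by linarith [n.cast_nonneg (α := ℝ)]) hc.continuousOn
        (show y ∈ Set.Icc (F (-n)) (F n) by
          rw [hneg, hnat]; constructor <;> linarith)
      exact ⟨x, hx⟩
    exact ⟨hm.orderIsoOfSurjective F hs, hF⟩
  · intro F hF
    obtain ⟨k, hk⟩ := coe_unitAddCircle_eq_iff.1 (hF 0).symm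
    rw [zero_add] at hk
    refine ⟨k, ?_⟩
    have hcomm : Commute F (OrderIso.addRight (1 : ℝ)) := hadd 1 F hF
    have hint : ∀ m : ℤ, F m = m + k := by
      intro m
      have h1 := congrArg (fun E : ℝ ≃o ℝ => E 0) (hcomm.zpow_right m).eq
      simp only [RelIso.mul_apply, addRight_one_zpow, zero_add] at h1
      rw [h1, ← hk]
      ring
    ext x
    rw [addRight_one_zpow]
    obtain ⟨m, hm⟩ := coe_unitAddCircle_eq_iff.1 (hF x).symm
    have h1 := F.monotone (Int.floor_le x)
    have h2 := F.strictMono (Int.lt_floor_add_one x)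
    rw [show ((⌊x⌋ : ℝ) + 1) = ((⌊x⌋ + 1 : ℤ) : ℝ) by push_cast; rfl] at h2
    rw [hint] at h1 h2
    push_cast at h2
    have h3 : ((m - k : ℤ) : ℝ) < 1 := by push_cast; linarith [Int.floor_le x]
    have h4 : (-1 : ℝ) < ((m - k : ℤ) : ℝ) := by push_cast; linarith [Int.lt_floor_add_one x]
    have h3' : m - k < 1 := by exact_mod_cast h3
    have h4' : -1 < m - k := by exact_mod_cast h4
    rw [← hm, show m = k by omega]
  · intro x y hxy
    obtain ⟨k, hk⟩ := coe_unitAddCircle_eq_iff.1 hxy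
    exact ⟨k, by rw [addRight_one_zpow, hk]⟩

theorem dense_Ioo_preimage_subtype_val {s : Set ℝ} (hs : s ⊆ Set.Icc 0 1) (hs' : Set.Ioo 0 1 ⊆ s) :
    Dense ((↑) ⁻¹' Set.Ioo (0 : ℝ) 1 : Set s) := by
  rw [Subtype.dense_iff, Subtype.image_preimage_coe, Set.inter_eq_right.2 hs',
    closure_Ioo zero_ne_one]
  exact hs

end Models

theorem theorem1p1 :
    -- M is the line
    (∀ G : Subgroup (ℝ ≃ₜ ℝ), (∀ g ∈ G, StrictMono g) → G.FG →
      Group.IsVirtuallyNilpotent G → OneDimDynamics.HasDecomposition G) ∧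
    -- M is the half-open interval
    (∀ G : Subgroup (Set.Ico (0 : ℝ) 1 ≃ₜ Set.Ico (0 : ℝ) 1), (∀ g ∈ G, StrictMono g) → G.FG →
      Group.IsVirtuallyNilpotent G → OneDimDynamics.HasDecomposition G) ∧
    -- M is the closed interval
    (∀ G : Subgroup (Set.Icc (0 : ℝ) 1 ≃ₜ Set.Icc (0 : ℝ) 1), (∀ g ∈ G, StrictMono g) → G.FG →
      Group.IsVirtuallyNilpotent G → OneDimDynamics.HasDecomposition G) ∧
    -- M is the circle
    (∀ G : Subgroup (UnitAddCircle ≃ₜ UnitAddCircle),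
      (∀ g ∈ G, OneDimDynamics.CircleOrientationPreserving g) → G.FG →
      Group.IsVirtuallyNilpotent G →
        OneDimDynamics.HasDecomposition G ∧
        (OneDimDynamics.ActsMinimallyOn G Set.univ → ∀ g ∈ G, ∀ h ∈ G, g * h = h * g)) := by
  refine ⟨?_, ?_, ?_, circle_structure⟩
  · refine hasDecomposition_of_linearOrder strictMono_id ?_ ?_ Function.surjective_id.denseRange
    · ext x; simp
    · simp
  · have hmem : ∀ x, Real.sigmoid x ∈ Set.Ico (0 : ℝ) 1 := fun x =>
      ⟨Real.sigmoid_nonneg x, Real.sigmoid_lt_one x⟩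
    have hr : Set.range (fun x => (⟨Real.sigmoid x, hmem x⟩ : Set.Ico (0 : ℝ) 1)) =
        (↑) ⁻¹' Set.Ioo (0 : ℝ) 1 := by
      rw [← Real.range_sigmoid]
      ext x
      simp [Subtype.ext_iff]
    refine hasDecomposition_of_linearOrder (π := fun x => ⟨Real.sigmoid x, hmem x⟩)
      (fun x y h => Real.sigmoid_strictMono h) ?_ ?_ ?_
    · rw [hr]
      ext ⟨x, hx⟩
      simp only [Set.mem_preimage, Set.mem_Ioo, Set.mem_ofPred_eq, not_isMin_iff, not_isMax_iff]
      constructor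
      · rintro ⟨h0, h1⟩
        exact ⟨⟨⟨0, le_rfl, one_pos⟩, h0⟩, ⟨⟨(x + 1) / 2, by linarith, by linarith⟩,
          show x < (x + 1) / 2 by linarith⟩⟩
      · rintro ⟨⟨a, ha⟩, -⟩
        exact ⟨a.2.1.trans_lt ha, hx.2⟩
    · rw [hr]; exact isOpen_Ioo.preimage continuous_subtype_val
    · rw [DenseRange, hr]
      exact dense_Ioo_preimage_subtype_val Set.Ico_subset_Icc_self Set.Ioo_subset_Ico_self
  · have hmem : ∀ x, Real.sigmoid x ∈ Set.Icc (0 : ℝ) 1 := fun x =>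
      ⟨Real.sigmoid_nonneg x, Real.sigmoid_le_one x⟩
    have hr : Set.range (fun x => (⟨Real.sigmoid x, hmem x⟩ : Set.Icc (0 : ℝ) 1)) =
        (↑) ⁻¹' Set.Ioo (0 : ℝ) 1 := by
      rw [← Real.range_sigmoid]
      ext x
      simp [Subtype.ext_iff]
    refine hasDecomposition_of_linearOrder (π := fun x => ⟨Real.sigmoid x, hmem x⟩)
      (fun x y h => Real.sigmoid_strictMono h) ?_ ?_ ?_
    · rw [hr]
      ext ⟨x, hx⟩
      simp only [Set.mem_preimage, Set.mem_Ioo, Set.mem_ofPred_eq, not_isMin_iff, not_isMax_iff]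
      constructor
      · rintro ⟨h0, h1⟩
        exact ⟨⟨⟨0, by simp⟩, h0⟩, ⟨⟨1, by simp⟩, h1⟩⟩
      · rintro ⟨⟨a, ha⟩, ⟨b, hb⟩⟩
        exact ⟨a.2.1.trans_lt ha, lt_of_lt_of_le hb b.2.2⟩
    · rw [hr]; exact isOpen_Ioo.preimage continuous_subtype_val
    · rw [DenseRange, hr]
      exact dense_Ioo_preimage_subtype_val subset_rfl Set.Ioo_subset_Icc_self
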